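/- A \emph{contextuality scenario} is a pair $\mathbb{G}=(V,E)$, where $V$ is a finite set and $E$ is a non-empty set of subsets of $V$ with $\bigcup_{e\in E}e=V$. A \emph{probabilistic model} of $\mathbb{G}$ is a function $p:V\to[0,1]$ with $\sum_{x\in e}p(x)=1$ for all $e\in E$; $\mathbb{G}$ is \emph{non-trivial} if it admits a probabilistic model. A \emph{positive operator representation} (POR) of $\mathbb{G}$ on a Hilbert space $\mathcal{H}$ is a family $(A_x)_{x\in V}$ of positive operators in $\mathcal{B}(\mathcal{H})$ with $\sum_{x\in e}A_x=I_{\mathcal{H}}$ for all $e\in E$. For $e\in E$ let $\ell^\infty_e$ be the space of complex functions on $e$, with canonical basis $(\delta^e_x)_{x\in e}$, and let $\mathcal{S}=\bigoplus_{e\in E}\ell^\infty_e$, with embeddings $\iota_e:\ell^\infty_e\to\mathcal{S}$; these are operator systems in the canonical way. Let $\tilde{\mathcal{J}}$ be the space of all $u=\oplus_{e}(u^e_x)_{x\in e}\in\mathcal{S}$ with $\sum_{e\in E}\sum_{x\in e}p(x)u^e_x=0$ for every probabilistic model $p$ of $\mathbb{G}$; it is an intersection of kernels of states. Let $\mathcal{S}_{\mathbb{G}}=\mathcal{S}/\tilde{\mathcal{J}}$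 be the operator system quotient with quotient map $q$: a matrix $Y\in M_n(\mathcal{S}_{\mathbb{G}})$ is positive if and only if for every $\varepsilon>0$ there is $X\in M_n(\mathcal{S})$ with $q^{(n)}(X)=Y$ and $\varepsilon 1+X\in M_n(\mathcal{S})^+$, and the unit is $q(1)$. Set $i_e=|E|\,(q\circ\iota_e):\ell^\infty_e\to\mathcal{S}_{\mathbb{G}}$ and $a_x=i_e(\delta^e_x)$ for $x\in e$, which does not depend on the choice of $e$. \textbf{Theorem.} Let $\mathbb{G}=(V,E)$ be a non-trivial contextuality scenario. (1) Let $\mathcal{H}$ be a Hilbert space. If $\Phi:\mathcal{S}_{\mathbb{G}}\to\mathcal{B}(\mathcal{H})$ is a unital completely positive map, then $(\Phi(a_x))_{x\in V}$ is a POR of $\mathbb{G}$. Conversely, if $(A_x)_{x\in V}\subseteq\mathcal{B}(\mathcal{H})$ is a POR of $\mathbb{G}$, then there exists a unique unital completely positive map $\Phi:\mathcal{S}_{\mathbb{G}}\to\mathcal{B}(\mathcal{H})$ such that $\Phi(a_x)=A_x$ for all $x\in V$. (2) The maps $i_e$, $e\in E$, are unital and completely positive. Suppose that $\mathcal{R}$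 is an (abstract) operator system and $r_e:\ell^\infty_e\to\mathcal{R}$, $e\in E$, are unital completely positive maps such that $r_e(\delta^e_x)=r_f(\delta^f_x)$ whenever $e,f\in E$ and $x\in e\cap f$, with the property that for every POR $(A_x)_{x\in V}$ of $\mathbb{G}$ on a Hilbert space $\mathcal{H}$ there exists a unique unital completely positive map $\Psi:\mathcal{R}\to\mathcal{B}(\mathcal{H})$ with $\Psi(r_e(\delta^e_x))=A_x$ for all $e\in E$ and $x\in e$. Then there exists a unital complete order isomorphism $\theta:\mathcal{R}\to\mathcal{S}_{\mathbb{G}}$ such that $\theta\circ r_e=i_e$ for all $e\in E$. -/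

import Mathlib

open scoped ComplexOrder

/-! ### Abstract operator systems -/

/-- The compression `T* X T` of a matrix `X` over a complex vector space by a scalar matrix `T`. -/
def matCompress {S : Type*} [AddCommGroup S] [Module ℂ S] {n m : ℕ}
    (T : Matrix (Fin n) (Fin m) ℂ) (X : Matrix (Fin n) (Fin n) S) :
    Matrix (Fin m) (Fin m) S :=
  Matrix.of fun i j => ∑ k, ∑ l, (star (T k i) * T l j) • X k l

lemma matCompress_add {S : Type*} [AddCommGroup S] [Module ℂ S] {n m : ℕ}
    (T : Matrix (Fin n) (Fin m) ℂ) (X Y : Matrix (Fin n) (Fin n) S) :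
    matCompress T (X + Y) = matCompress T X + matCompress T Y := by
  ext i j
  simp [matCompress, Finset.sum_add_distrib]

lemma matCompress_smul {S : Type*} [AddCommGroup S] [Module ℂ S] {n m : ℕ}
    (T : Matrix (Fin n) (Fin m) ℂ) (c : ℂ) (X : Matrix (Fin n) (Fin n) S) : matCompress T (c • X) = c • matCompress T X := by
  ext i j
  simp only [matCompress, Matrix.smul_apply, Matrix.of_apply, Finset.smul_sum]
  exact Finset.sum_congr rfl fun k _ => Finset.sum_congr rfl fun l _ => smul_comm _ _ _

/-- An (abstract) operator system structure on a complex `*`-vector space `S`: a matrix ordering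
by proper cones `M_n(S)⁺ ⊆ M_n(S)_h`, with an Archimedean matrix order unit. -/
class OperatorSystem (S : Type*) [AddCommGroup S] [Module ℂ S] [StarAddMonoid S]
    [StarModule ℂ S] where
  /-- the unit -/
  unit : S
  /-- the cone `M_n(S)⁺` -/
  cone : (n : ℕ) → Set (Matrix (Fin n) (Fin n) S)
  isHermitian_of_mem : ∀ {n : ℕ} {X : Matrix (Fin n) (Fin n) S}, X ∈ cone n → X.IsHermitian
  zero_mem : ∀ n : ℕ, (0 : Matrix (Fin n) (Fin n) S) ∈ cone n
  add_mem : ∀ {n : ℕ} {X Y : Matrix (Fin n) (Fin n) S},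
    X ∈ cone n → Y ∈ cone n → X + Y ∈ cone n
  smul_mem : ∀ {n : ℕ} {r : ℝ} {X : Matrix (Fin n) (Fin n) S},
    0 ≤ r → X ∈ cone n → (r : ℂ) • X ∈ cone n
  proper : ∀ {n : ℕ} {X : Matrix (Fin n) (Fin n) S}, X ∈ cone n → -X ∈ cone n → X = 0
  compress_mem : ∀ {n m : ℕ} (T : Matrix (Fin n) (Fin m) ℂ) {X : Matrix (Fin n) (Fin n) S},
    X ∈ cone n → matCompress T X ∈ cone m
  isHermitian_unit : star unit = unit
  order_unit : ∀ {n : ℕ} (X : Matrix (Fin n) (Fin n) S), X.IsHermitian →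
    ∃ r : ℝ, 0 < r ∧ (r : ℂ) • Matrix.diagonal (fun _ : Fin n => unit) - X ∈ cone n
  archimedean : ∀ {n : ℕ} (X : Matrix (Fin n) (Fin n) S),
    (∀ r : ℝ, 0 < r → (r : ℂ) • Matrix.diagonal (fun _ : Fin n => unit) + X ∈ cone n) →
      X ∈ cone n

namespace OperatorSystem

/-- The unit `1 ⊗ I_n` of `M_n(S)`. -/
def matUnit (S : Type*) [AddCommGroup S] [Module ℂ S] [StarAddMonoid S] [StarModule ℂ S]
    [OperatorSystem S] (n : ℕ) : Matrix (Fin n) (Fin n) S :=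
  Matrix.diagonal (fun _ => unit)

section maps

variable {S T : Type*} [AddCommGroup S] [Module ℂ S] [StarAddMonoid S] [StarModule ℂ S]
  [OperatorSystem S] [AddCommGroup T] [Module ℂ T] [StarAddMonoid T] [StarModule ℂ T]
  [OperatorSystem T]

/-- A linear map is completely positive if all its amplifications (entrywise application to
`n × n` matrices) are positive. -/
def IsCP (φ : S →ₗ[ℂ] T) : Prop :=
  ∀ (n : ℕ) (X : Matrix (Fin n) (Fin n) S), X ∈ cone n → X.map φ ∈ (cone n : Set (Matrix _ _ T))

/-- Unital completely positive maps. -/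
def IsUCP (φ : S →ₗ[ℂ] T) : Prop :=
  φ unit = unit ∧ IsCP φ

/-- Unital complete order isomorphisms. -/
def IsUnitalCompleteOrderIso (φ : S ≃ₗ[ℂ] T) : Prop :=
  IsUCP (φ : S →ₗ[ℂ] T) ∧ IsCP (φ.symm : T →ₗ[ℂ] S)

/-- States: unital positive linear functionals. -/
def IsState (f : S →ₗ[ℂ] ℂ) : Prop :=
  f unit = 1 ∧ ∀ x : S, Matrix.of (fun _ _ : Fin 1 => x) ∈ cone 1 → 0 ≤ f x

end maps

/-! ### Scalar matrices: auxiliary facts -/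

lemma quad_bound {H : Type*} [NormedAddCommGroup H] [InnerProductSpace ℂ H] {n : ℕ}
    (X : Matrix (Fin n) (Fin n) (H →L[ℂ] H)) (ξ : Fin n → H) :
    ‖∑ i, ∑ j, inner ℂ (ξ i) (X i j (ξ j))‖ ≤ (∑ i, ∑ j, ‖X i j‖) * ∑ k, ‖ξ k‖ ^ 2 := by
  have key : ∀ i j, ‖inner ℂ (ξ i) (X i j (ξ j))‖ ≤ ‖X i j‖ * ∑ k, ‖ξ k‖ ^ 2 := by
    intro i j
    have h1 : ‖inner ℂ (ξ i) (X i j (ξ j))‖ ≤ ‖ξ i‖ * (‖X i j‖ * ‖ξ j‖) :=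
      (norm_inner_le_norm _ _).trans
        (mul_le_mul_of_nonneg_left ((X i j).le_opNorm _) (norm_nonneg _))
    have hi : ‖ξ i‖ ^ 2 ≤ ∑ k, ‖ξ k‖ ^ 2 :=
      Finset.single_le_sum (f := fun k => ‖ξ k‖ ^ 2) (fun _ _ => by positivity)
        (Finset.mem_univ i)
    have hj : ‖ξ j‖ ^ 2 ≤ ∑ k, ‖ξ k‖ ^ 2 :=
      Finset.single_le_sum (f := fun k => ‖ξ k‖ ^ 2) (fun _ _ => by positivity)
        (Finset.mem_univ j)
    have h2 : ‖ξ i‖ * ‖ξ j‖ ≤ ∑ k, ‖ξ k‖ ^ 2 := by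
      nlinarith [sq_nonneg (‖ξ i‖ - ‖ξ j‖)]
    calc _ ≤ ‖X i j‖ * (‖ξ i‖ * ‖ξ j‖) := by linarith
      _ ≤ _ := mul_le_mul_of_nonneg_left h2 (norm_nonneg _)
  calc _ ≤ ∑ i, ∑ j, ‖inner ℂ (ξ i) (X i j (ξ j))‖ :=
        (norm_sum_le _ _).trans (Finset.sum_le_sum fun i _ => norm_sum_le _ _)
    _ ≤ ∑ i, ∑ j, ‖X i j‖ * ∑ k, ‖ξ k‖ ^ 2 :=
        Finset.sum_le_sum fun i _ => Finset.sum_le_sum fun j _ => key i j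
    _ = _ := by simp_rw [← Finset.sum_mul]

lemma nonneg_of_forall_eps {z : ℂ} {c : ℝ} (hc : 0 ≤ c)
    (h : ∀ r : ℝ, 0 < r → 0 ≤ (r : ℂ) * (c : ℂ) + z) : 0 ≤ z := by
  have him : z.im = 0 := by
    have := (Complex.nonneg_iff.1 (h 1 one_pos)).2
    simpa using this.symm
  refine Complex.nonneg_iff.2 ⟨?_, him.symm⟩
  by_contra hz
  push Not at hz
  have h1 := (Complex.nonneg_iff.1 (h (-z.re / (2 * (c + 1))) (by
    apply div_pos <;> linarith))).1
  rw [← Complex.ofReal_mul, Complex.add_re, Complex.ofReal_re] at h1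
  have : -z.re / (2 * (c + 1)) * c ≤ -z.re / 2 := by
    rw [div_mul_eq_mul_div, div_le_div_iff₀ (by linarith) (by norm_num)]
    nlinarith
  linarith

lemma eq_zero_of_nonneg_of_neg_nonneg {z : ℂ} (h : 0 ≤ z) (h' : 0 ≤ -z) : z = 0 :=
  le_antisymm (neg_nonneg.1 h') h

/-! ### The operator system `B(H)` -/

section BH

variable {H : Type*} [NormedAddCommGroup H] [InnerProductSpace ℂ H]

lemma quad_add_smul {n : ℕ} (X : Matrix (Fin n) (Fin n) (H →L[ℂ] H)) (r : ℂ) (ξ : Fin n → H) :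
    ∑ i, ∑ j, inner ℂ (ξ i)
      ((r • Matrix.diagonal (fun _ : Fin n => (1 : H →L[ℂ] H)) + X) i j (ξ j)) =
    r * ((∑ k, ‖ξ k‖ ^ 2 : ℝ) : ℂ) + ∑ i, ∑ j, inner ℂ (ξ i) (X i j (ξ j)) := by
  have : ∀ i j, inner ℂ (ξ i)
      ((r • Matrix.diagonal (fun _ : Fin n => (1 : H →L[ℂ] H)) + X) i j (ξ j)) =
      (if i = j then r * ((‖ξ i‖ ^ 2 : ℝ) : ℂ) else 0) + inner ℂ (ξ i) (X i j (ξ j)) := by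
    intro i j
    by_cases hij : i = j
    · subst hij
      simp [inner_self_eq_norm_sq_to_K]
    · simp [hij]
  simp_rw [this, Finset.sum_add_distrib]
  congr 1
  simp [Finset.mul_sum]

variable [CompleteSpace H]

lemma quad_im_zero {n : ℕ} {X : Matrix (Fin n) (Fin n) (H →L[ℂ] H)} (hX : X.IsHermitian)
    (ξ : Fin n → H) : (∑ i, ∑ j, inner ℂ (ξ i) (X i j (ξ j))).im = 0 := by
  rw [← Complex.conj_eq_iff_im, map_sum]
  simp_rw [map_sum, inner_conj_symm]
  rw [Finset.sum_comm]
  refine Finset.sum_congr rfl fun i _ => Finset.sum_congr rfl fun j _ => ?_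
  have : X j i = ContinuousLinearMap.adjoint (X i j) := (hX.apply j i).symm
  rw [this, ContinuousLinearMap.adjoint_inner_left]

/-- `B(H)` as an operator system: `M_n(B(H)) = B(Hⁿ)`, so `X ∈ M_n(B(H))` is positive
iff `⟨X ξ, ξ⟩ ≥ 0` for all `ξ ∈ Hⁿ`. -/
instance instBH : OperatorSystem (H →L[ℂ] H) where
  unit := 1
  cone n := {X | X.IsHermitian ∧ ∀ ξ : Fin n → H, 0 ≤ ∑ i, ∑ j, inner ℂ (ξ i) (X i j (ξ j))}
  isHermitian_of_mem h := h.1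
  zero_mem n := ⟨Matrix.isHermitian_zero, by simp⟩
  add_mem hX hY := ⟨hX.1.add hY.1, fun ξ => by
    have := add_nonneg (hX.2 ξ) (hY.2 ξ)
    simpa [inner_add_right, Finset.sum_add_distrib] using this⟩
  smul_mem {n r X} hr hX := by
    refine ⟨?_, fun ξ => ?_⟩
    · ext1 i j
      have := hX.1.apply i j
      simp [this]
    · have := mul_nonneg (Complex.zero_le_real.2 hr) (hX.2 ξ)
      simpa [inner_smul_right, Finset.mul_sum] using this
  proper {n X} hX hX' := by
    have h0 : ∀ ξ : Fin n → H, ∑ i, ∑ j, inner ℂ (ξ i) (X i j (ξ j)) = 0 := fun ξ =>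
      eq_zero_of_nonneg_of_neg_nonneg (hX.2 ξ) (by simpa using hX'.2 ξ)
    have hexp : ∀ ξ η : Fin n → H, (∑ i, ∑ j, inner ℂ (ξ i) (X i j (η j))) +
        ∑ i, ∑ j, inner ℂ (η i) (X i j (ξ j)) = 0 := by
      intro ξ η
      have h1 := h0 (ξ + η)
      have h2 := h0 ξ
      have h3 := h0 η
      simp only [Pi.add_apply, map_add, inner_add_left, inner_add_right,
        Finset.sum_add_distrib] at h1
      linear_combination h1 - h2 - h3
    have hz : ∀ ξ η : Fin n → H, ∑ i, ∑ j, inner ℂ (ξ i) (X i j (η j)) = 0 := by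
      intro ξ η
      have h1 := hexp ξ η
      have h2 := hexp ξ (Complex.I • η)
      simp only [Pi.smul_apply, map_smul, inner_smul_left, inner_smul_right, Complex.conj_I,
        ← Finset.mul_sum] at h2
      have h3 : Complex.I * (2 * ∑ i, ∑ j, inner ℂ (ξ i) (X i j (η j))) = 0 := by
        linear_combination h2 + Complex.I * h1
      simpa using h3
    ext i j v
    have := hz (Pi.single i (X i j v)) (Pi.single j v)
    rw [Finset.sum_eq_single i, Finset.sum_eq_single j] at this
    · simpa using this
    · intro b _ hb; simp [hb]
    · simp
    · intro b _ hb; simp [hb]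
    · simp
  compress_mem {n m} T {X} hX := by
    refine ⟨?_, fun ξ => ?_⟩
    · ext1 i j
      simp only [Matrix.conjTranspose_apply, matCompress, Matrix.of_apply, star_sum, star_smul]
      rw [Finset.sum_comm]
      refine Finset.sum_congr rfl fun k _ => Finset.sum_congr rfl fun l _ => ?_
      rw [hX.1.apply]
      simp [mul_comm]
    · have := hX.2 (fun k => ∑ i, T k i • ξ i)
      convert this using 1
      have h1 : ∀ i j, inner ℂ (ξ i) (matCompress T X i j (ξ j)) =
          ∑ k, ∑ l, (star (T k i) * T l j) * inner ℂ (ξ i) (X k l (ξ j)) := by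
        intro i j
        simp [matCompress, sum_apply]
      have h2 : ∀ k l, inner ℂ (∑ i, T k i • ξ i) (X k l (∑ j, T l j • ξ j)) =
          ∑ i, ∑ j, (star (T k i) * T l j) * inner ℂ (ξ i) (X k l (ξ j)) := by
        intro k l
        rw [sum_inner]
        refine Finset.sum_congr rfl fun i _ => ?_
        rw [map_sum, inner_sum]
        refine Finset.sum_congr rfl fun j _ => ?_
        rw [map_smul, inner_smul_left, inner_smul_right, starRingEnd_apply]
        ring
      simp_rw [h1, h2]
      exact (Finset.sum_congr rfl fun i _ => Finset.sum_comm).trans <| Finset.sum_comm.trans <|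
        Finset.sum_congr rfl fun k _ =>
          (Finset.sum_congr rfl fun i _ => Finset.sum_comm).trans Finset.sum_comm
  isHermitian_unit := star_one _
  order_unit {n} X hX := by
    set c := ∑ i, ∑ j, ‖X i j‖ with hc
    have hc0 : 0 ≤ c := by positivity
    refine ⟨c + 1, by linarith, ?_, fun ξ => ?_⟩
    · ext1 i j
      have := hX.apply i j
      by_cases hij : i = j
      · subst hij; simp [this]
      · simp [this, hij, Ne.symm hij]
    · rw [sub_eq_add_neg, quad_add_smul]
      have hb := quad_bound X ξ
      have him := quad_im_zero hX ξ
      set q := ∑ i, ∑ j, inner ℂ (ξ i) (X i j (ξ j)) with hq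
      have hneg : ∑ i, ∑ j, inner ℂ (ξ i) ((-X) i j (ξ j)) = -q := by simp [hq]
      rw [hneg, ← Complex.ofReal_mul]
      have hs : 0 ≤ ∑ k, ‖ξ k‖ ^ 2 := by positivity
      have := (Complex.re_le_norm q).trans hb
      refine Complex.nonneg_iff.2 ⟨?_, by
        rw [Complex.add_im, Complex.ofReal_im, Complex.neg_im, him, neg_zero, add_zero]⟩
      rw [Complex.add_re, Complex.ofReal_re, Complex.neg_re]
      nlinarith
  archimedean {n} X h := by
    refine ⟨?_, fun ξ => ?_⟩
    · have := (h 1 one_pos).1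
      ext1 i j
      have := this.apply i j
      by_cases hij : i = j
      · subst hij; simpa using this
      · simpa [hij, Ne.symm hij] using this
    · refine nonneg_of_forall_eps (c := ∑ k, ‖ξ k‖ ^ 2) (by positivity) fun r hr => ?_
      have := (h r hr).2 ξ
      rwa [quad_add_smul] at this

end BH

/-! ### The finite dimensional commutative C*-algebras `ℓ^∞(ι)` -/

lemma exists_smul_one_sub_posSemidef {n : ℕ} {M : Matrix (Fin n) (Fin n) ℂ}
    (hM : M.IsHermitian) :
    ∃ r : ℝ, 0 < r ∧ ((r : ℂ) • (1 : Matrix (Fin n) (Fin n) ℂ) - M).PosSemidef := by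
  have hX : (M.map fun z => z • (1 : ℂ →L[ℂ] ℂ)).IsHermitian := by
    ext1 i j
    rw [Matrix.conjTranspose_apply, Matrix.map_apply, Matrix.map_apply, star_smul, star_one,
      hM.apply i j]
  obtain ⟨r, hr, h⟩ := order_unit _ hX
  refine ⟨r, hr, .of_dotProduct_mulVec_nonneg ?_ fun v => ?_⟩
  · ext1 i j
    have := hM.apply i j
    by_cases hij : i = j
    · subst hij; simpa using this
    · simpa [Matrix.one_apply, hij, Ne.symm hij] using this
  · convert h.2 v using 1
    simp only [dotProduct, Matrix.mulVec, Finset.mul_sum]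
    refine Finset.sum_congr rfl fun i _ => Finset.sum_congr rfl fun j _ => ?_
    by_cases hij : i = j
    · subst hij
      simp [unit]; ring
    · simp [hij]; ring

lemma posSemidef_of_forall_eps {n : ℕ} {M : Matrix (Fin n) (Fin n) ℂ}
    (h : ∀ r : ℝ, 0 < r → ((r : ℂ) • (1 : Matrix (Fin n) (Fin n) ℂ) + M).PosSemidef) :
    M.PosSemidef := by
  refine .of_dotProduct_mulVec_nonneg ?_ fun v => ?_
  · have := (h 1 one_pos).1
    simpa using this.sub Matrix.isHermitian_one
  · refine nonneg_of_forall_eps (c := ∑ k, ‖v k‖ ^ 2) (by positivity) fun r hr => ?_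
    have := (h r hr).dotProduct_mulVec_nonneg v
    rw [Matrix.add_mulVec, dotProduct_add, Matrix.smul_mulVec, Matrix.one_mulVec,
      dotProduct_smul] at this
    convert this using 2
    simp [dotProduct, Complex.conj_mul']

open scoped MatrixOrder in
lemma eq_zero_of_posSemidef_neg {n : ℕ} {M : Matrix (Fin n) (Fin n) ℂ}
    (h : M.PosSemidef) (h' : (-M).PosSemidef) : M = 0 :=
  le_antisymm (neg_nonneg.1 (Matrix.nonneg_iff_posSemidef.2 h'))
    (Matrix.nonneg_iff_posSemidef.2 h)

/-- `ℓ^∞(ι)`, `ι` finite, as an operator system: `M_n(ℓ^∞(ι)) = ⊕_{i ∈ ι} M_n`. -/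
instance instEllInfty {ι : Type*} [Finite ι] : OperatorSystem (ι → ℂ) where
  unit := 1
  cone n := {X | ∀ i, (X.map fun u => u i).PosSemidef}
  isHermitian_of_mem {n X} h := by
    ext k l i
    exact (h i).1.apply k l
  zero_mem n i := by
    convert Matrix.PosSemidef.zero using 1
    ext; simp
  add_mem {n X Y} hX hY i := by
    convert (hX i).add (hY i) using 1
    ext; simp
  smul_mem {n r X} hr hX i := by
    convert (hX i).smul (Complex.zero_le_real.2 hr) using 1
    ext; simp
  proper {n X} hX hX' := by
    ext k l i
    exact congrFun₂ (eq_zero_of_posSemidef_neg (hX i) (by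
      convert hX' i using 1
      ext; simp)) k l
  compress_mem {n m} T {X} hX i := by
    convert (hX i).conjTranspose_mul_mul_same T using 1
    ext k l
    simp only [matCompress, Matrix.map_apply, Matrix.of_apply, Finset.sum_apply, Pi.smul_apply, smul_eq_mul,
      Matrix.mul_apply, Matrix.conjTranspose_apply, Finset.sum_mul]
    rw [Finset.sum_comm]
    exact Finset.sum_congr rfl fun a _ => Finset.sum_congr rfl fun b _ => by ring
  isHermitian_unit := star_one _
  order_unit {n} X hX := by
    have : ∀ i, ∃ r : ℝ, 0 < r ∧
        ((r : ℂ) • (1 : Matrix (Fin n) (Fin n) ℂ) - X.map fun u => u i).PosSemidef := by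
      intro i
      refine exists_smul_one_sub_posSemidef ?_
      ext k l
      exact congrFun (hX.apply k l) i
    choose r hr h using this
    have := Fintype.ofFinite ι
    refine ⟨1 + ∑ i, r i,
      add_pos_of_pos_of_nonneg one_pos (Finset.sum_nonneg fun j _ => (hr j).le), fun i => ?_⟩
    have hi : r i ≤ ∑ i, r i :=
      Finset.single_le_sum (f := r) (fun j _ => (hr j).le) (Finset.mem_univ i)
    convert (h i).add ((Matrix.PosSemidef.one (n := Fin n) (R := ℂ)).smul
      (Complex.zero_le_real.2 (show 0 ≤ 1 + ∑ i, r i - r i by linarith))) using 1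
    ext k l
    by_cases hkl : k = l
    · subst hkl; simp
    · simp [hkl]
  archimedean {n} X h i := by
    refine posSemidef_of_forall_eps fun r hr => ?_
    convert h r hr i using 1
    ext k l
    by_cases hkl : k = l
    · subst hkl; simp
    · simp [hkl]

/-! ### Quotients of operator systems by kernels -/

section quotient

variable {S : Type*} [AddCommGroup S] [Module ℂ S] [StarAddMonoid S] [StarModule ℂ S]
  [OperatorSystem S]

lemma smul_matUnit_mem (n : ℕ) {ε : ℝ} (hε : 0 ≤ ε) : (ε : ℂ) • matUnit S n ∈ cone n := by
  obtain ⟨r, hr, h⟩ := order_unit (S := S) (n := n) 0 Matrix.isHermitian_zero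
  have := smul_mem (r := ε / r) (by positivity) h
  rwa [sub_zero, smul_smul, ← Complex.ofReal_mul, div_mul_cancel₀ _ hr.ne'] at this

lemma IsState.map_star {f : S →ₗ[ℂ] ℂ} (hf : IsState f) (x : S) : f (star x) = star (f x) := by
  have herm : ∀ y : S, star y = y → (f y).im = 0 := by
    intro y hy
    obtain ⟨r, -, h⟩ := order_unit (Matrix.of fun _ _ : Fin 1 => y) (by
      ext i j; exact hy)
    have h' : Matrix.of (fun _ _ : Fin 1 => (r : ℂ) • unit - y) ∈ cone 1 := by
      have he : Matrix.of (fun _ _ : Fin 1 => (r : ℂ) • unit - y) =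
          (r : ℂ) • Matrix.diagonal (fun _ : Fin 1 => unit) - Matrix.of (fun _ _ => y) := by
        ext i j
        obtain rfl := Subsingleton.elim i j
        rw [Matrix.sub_apply, Matrix.smul_apply, Matrix.diagonal_apply_eq, Matrix.of_apply,
          Matrix.of_apply]
      rw [he]
      exact h
    have := (Complex.nonneg_iff.1 (hf.2 _ h')).2
    simpa [hf.1] using this
  have h1 := herm (x + star x) (by simp [add_comm])
  have h2 := herm (Complex.I • (x - star x)) (by simp [← smul_neg])
  simp at h1 h2
  apply Complex.ext
  · simp; linarith
  · simp; linarith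

lemma IsState.map_posSemidef {f : S →ₗ[ℂ] ℂ} (hf : IsState f) {n : ℕ}
    {X : Matrix (Fin n) (Fin n) S} (hX : X ∈ cone n) : (X.map f).PosSemidef := by
  refine .of_dotProduct_mulVec_nonneg ?_ fun v => ?_
  · ext1 i j
    rw [Matrix.conjTranspose_apply, Matrix.map_apply, ← hf.map_star,
      (isHermitian_of_mem hX).apply i j, Matrix.map_apply]
  · have := hf.2 (∑ k, ∑ l, (star (v k) * v l) • X k l)
      (compress_mem (m := 1) (Matrix.of fun k _ => v k) hX)
    convert this using 1
    simp only [dotProduct, Matrix.mulVec, Finset.mul_sum, map_sum, map_smul, smul_eq_mul]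
    exact Finset.sum_congr rfl fun a _ => Finset.sum_congr rfl fun b _ => by
      simp only [Pi.star_apply, Matrix.map_apply]; ring

variable (S) in
/-- A kernel in `S`: a subspace that is an intersection of kernels of states
(equivalently, the kernel of a completely positive map on `S`). -/
structure Kernel where
  /-- the underlying subspace -/
  carrier : Submodule ℂ S
  isKernel : ∃ F : Set (S →ₗ[ℂ] ℂ), (∀ f ∈ F, IsState f) ∧
    ∀ u, u ∈ carrier ↔ ∀ f ∈ F, f u = 0

/-- The quotient vector space `S / K`. -/
def QuotientSystem (K : Kernel S) : Type _ := S ⧸ K.carrier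

namespace QuotientSystem

variable (K : Kernel S)

instance : AddCommGroup (QuotientSystem K) := inferInstanceAs (AddCommGroup (S ⧸ K.carrier))
instance : Module ℂ (QuotientSystem K) := inferInstanceAs (Module ℂ (S ⧸ K.carrier))

/-- The quotient map. -/
def mk : S →ₗ[ℂ] QuotientSystem K := K.carrier.mkQ

lemma mk_surjective : Function.Surjective (mk K) := K.carrier.mkQ_surjective

lemma mk_eq_zero {x : S} : mk K x = 0 ↔ x ∈ K.carrier := Submodule.Quotient.mk_eq_zero _

lemma star_mem {x : S} (hx : x ∈ K.carrier) : star x ∈ K.carrier := by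
  obtain ⟨F, hF, h⟩ := K.isKernel
  rw [h] at hx ⊢
  intro f hf
  rw [(hF f hf).map_star, hx f hf, star_zero]

instance : Star (QuotientSystem K) where
  star := K.carrier.mapQ K.carrier ((starLinearEquiv ℂ : S ≃ₗ⋆[ℂ] S) : S →ₗ⋆[ℂ] S)
    (fun _ hx => star_mem K hx)

lemma star_mk (x : S) : star (mk K x) = mk K (star x) := rfl

instance : StarAddMonoid (QuotientSystem K) where
  star_involutive y := by
    obtain ⟨x, rfl⟩ := mk_surjective K y
    rw [star_mk, star_mk, star_star]
  star_add y z := by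
    obtain ⟨x, rfl⟩ := mk_surjective K y
    obtain ⟨w, rfl⟩ := mk_surjective K z
    rw [← map_add, star_mk, star_mk, star_mk, star_add, map_add]

instance : StarModule ℂ (QuotientSystem K) where
  star_smul c y := by
    obtain ⟨x, rfl⟩ := mk_surjective K y
    rw [← map_smul, star_mk, star_mk, star_smul, map_smul]

/-- The quotient operator system. A matrix over `S / K` is positive iff for every `ε > 0` it has
a lift `X` to a matrix over `S` with `ε 1 + X` positive. -/
instance instQuotient : OperatorSystem (QuotientSystem K) where
  unit := mk K unit
  cone n := {Y | ∀ ε : ℝ, 0 < ε → ∃ X : Matrix (Fin n) (Fin n) S,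
    X.map (mk K) = Y ∧ (ε : ℂ) • matUnit S n + X ∈ cone n}
  isHermitian_of_mem {n Y} h := by
    obtain ⟨X, rfl, hX⟩ := h 1 one_pos
    ext1 i j
    have := (isHermitian_of_mem hX).apply i j
    by_cases hij : i = j
    · subst hij
      simp [matUnit, isHermitian_unit] at this
      simp [star_mk, this]
    · simp [matUnit, hij, Ne.symm hij] at this
      simp [star_mk, this]
  zero_mem n ε hε := by
    refine ⟨0, by ext; simp, ?_⟩
    rw [add_zero]
    exact smul_matUnit_mem n hε.le
  add_mem {n Y Z} hY hZ ε hε := by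
    obtain ⟨X, rfl, hX⟩ := hY (ε / 2) (by positivity)
    obtain ⟨W, rfl, hW⟩ := hZ (ε / 2) (by positivity)
    refine ⟨X + W, by ext; simp, ?_⟩
    convert add_mem hX hW using 1
    rw [add_add_add_comm, ← add_smul, ← Complex.ofReal_add, add_halves]
  smul_mem {n r Y} hr hY ε hε := by
    obtain ⟨X, rfl, hX⟩ := hY (ε / (r + 1)) (by positivity)
    refine ⟨(r : ℂ) • X, by ext; simp, ?_⟩
    have h0 : 0 ≤ ε - r * (ε / (r + 1)) := by
      have : r * (ε / (r + 1)) = ε - ε / (r + 1) := by field_simp; ring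
      rw [this, sub_sub_cancel]
      positivity
    convert add_mem (smul_mem hr hX) (smul_matUnit_mem n h0) using 1
    push_cast
    module
  proper {n Y} hY hY' := by
    obtain ⟨F, hF, hK⟩ := K.isKernel
    obtain ⟨X, rfl, -⟩ := hY 1 one_pos
    have heq : ∀ f ∈ F, ∀ a b : S, mk K a = mk K b → f a = f b := by
      intro f hf a b hab
      rw [← sub_eq_zero, ← map_sub]
      exact (hK _).1 ((mk_eq_zero K).1 (by rw [map_sub, hab, sub_self])) f hf
    have key : ∀ f ∈ F, ∀ Z : Matrix (Fin n) (Fin n) S, (∀ ε : ℝ, 0 < ε →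
        ∃ W : Matrix (Fin n) (Fin n) S, W.map (mk K) = Z.map (mk K) ∧
          (ε : ℂ) • matUnit S n + W ∈ cone n) → (Z.map f).PosSemidef := by
      intro f hf Z hZ
      refine posSemidef_of_forall_eps fun ε hε => ?_
      obtain ⟨W, hW, hWc⟩ := hZ ε hε
      convert (hF f hf).map_posSemidef hWc using 1
      ext i j
      have := heq f hf _ _ (congrFun₂ hW i j)
      by_cases hij : i = j
      · subst hij
        simp [matUnit, (hF f hf).1, this]
      · simp [matUnit, hij, this]
    ext i j
    refine (mk_eq_zero K).2 ((hK _).2 fun f hf => ?_)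
    have h1 := key f hf X hY
    have h2 := key f hf (-X) (by
      intro ε hε
      obtain ⟨W, hW, hWc⟩ := hY' ε hε
      exact ⟨W, by rw [hW]; ext; simp, hWc⟩)
    exact congrFun₂ (eq_zero_of_posSemidef_neg h1 (by convert h2 using 1; ext; simp)) i j
  compress_mem {n m} T {Y} hY ε hε := by
    have hu : matUnit S n ∈ cone n := by simpa using smul_matUnit_mem (S := S) n zero_le_one
    obtain ⟨r, hr, h⟩ := order_unit _ (isHermitian_of_mem (compress_mem T hu))
    obtain ⟨X, rfl, hX⟩ := hY (ε / r) (by positivity)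
    refine ⟨matCompress T X, by ext; simp [matCompress], ?_⟩
    convert add_mem (compress_mem T hX) (smul_mem (r := ε / r) (by positivity) h) using 1
    rw [matCompress_add, matCompress_smul, smul_sub, smul_smul, ← Complex.ofReal_mul,
      div_mul_cancel₀ _ hr.ne', matUnit]
    abel
  isHermitian_unit := by rw [star_mk, isHermitian_unit]
  order_unit {n} Y hY := by
    choose g hg using mk_surjective K
    let X₀ : Matrix (Fin n) (Fin n) S := Y.map g
    let X : Matrix (Fin n) (Fin n) S := (1 / 2 : ℂ) • (X₀ + X₀.conjTranspose)
    have hX : X.IsHermitian := by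
      ext1 i j
      simp [X, add_comm]
    have hXY : X.map (mk K) = Y := by
      ext i j
      have := hY.apply i j
      simp only [X, X₀, Matrix.map_apply, Matrix.smul_apply, Matrix.add_apply,
        Matrix.conjTranspose_apply, map_smul, map_add, ← star_mk, hg, this]
      module
    obtain ⟨r, hr, h⟩ := order_unit X hX
    refine ⟨r, hr, fun ε hε => ⟨_, ?_, add_mem (smul_matUnit_mem n hε.le) h⟩⟩
    rw [← hXY]
    ext i j
    by_cases hij : i = j
    · subst hij; simp
    · simp [hij]
  archimedean {n} Y h ε hε := by
    obtain ⟨X, hX, hXc⟩ := h (ε / 2) (by positivity) (ε / 2) (by positivity)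
    refine ⟨X - ((ε / 2 : ℝ) : ℂ) • matUnit S n, ?_, ?_⟩
    · ext i j
      have := congrFun₂ hX i j
      simp only [Matrix.map_apply] at this
      by_cases hij : i = j
      · subst hij; simp [this, matUnit]
      · simp [hij, this, matUnit]
    · convert hXc using 1
      push_cast
      module

end QuotientSystem

end quotient

end OperatorSystem

/-! ### Contextuality scenarios -/

/-- A contextuality scenario: a non-empty set of subsets (edges) of a finite set `V` that
cover `V`. -/
structure ContextualityScenario (V : Type*) [Finite V] where
  edges : Finset (Finset V)
  nonempty : edges.Nonempty
  cover : ∀ x : V, ∃ e ∈ edges, x ∈ e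

namespace ContextualityScenario

variable {V : Type*} [Finite V] (G : ContextualityScenario V)

/-- Probabilistic models of `G`. -/
def IsProbModel (p : V → ℝ) : Prop :=
  (∀ x, p x ∈ Set.Icc (0 : ℝ) 1) ∧ ∀ e ∈ G.edges, ∑ x ∈ e, p x = 1

/-- `G` is non-trivial if it admits a probabilistic model. -/
def Nontrivial : Prop := ∃ p : V → ℝ, G.IsProbModel p

/-- Positive operator representations (POR) of `G` on `H`. -/
def IsPOR {H : Type*} [NormedAddCommGroup H] [InnerProductSpace ℂ H] [CompleteSpace H]
    (A : V → (H →L[ℂ] H)) : Prop :=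
  (∀ x, (A x).IsPositive) ∧ ∀ e ∈ G.edges, ∑ x ∈ e, A x = 1

/-- The type of edges of `G`. -/
abbrev Edge : Type _ := {e : Finset V // e ∈ G.edges}

/-- The space `ℓ^∞_e`. -/
abbrev EllInfty {G : ContextualityScenario V} (e : G.Edge) : Type _ := {x : V // x ∈ e.1} → ℂ

/-- The direct sum `⊕_e ℓ^∞_e`, as functions `(e, x) ↦ u_x^e` on the disjoint union of the
edges. -/
abbrev DirectSum : Type _ := (Σ e : G.Edge, {x : V // x ∈ e.1}) → ℂ

/-- The pairing `⟨p, u⟩ = ∑_e ∑_{x ∈ e} p(x) u_x^e`. -/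
def pairing (p : V → ℝ) : G.DirectSum →ₗ[ℂ] ℂ where
  toFun u := ∑ e : G.Edge, ∑ x : {x : V // x ∈ e.1}, (p x : ℂ) * u ⟨e, x⟩
  map_add' u v := by simp [mul_add, Finset.sum_add_distrib]
  map_smul' c u := by simp [Finset.mul_sum, mul_left_comm]

lemma pairing_apply (p : V → ℝ) (u : G.DirectSum) : G.pairing p u =
    ∑ e : G.Edge, ∑ x : {x : V // x ∈ e.1}, (p x : ℂ) * u ⟨e, x⟩ := rfl

/-- The subspace `{u : ⟨p, u⟩ = 0 for all probabilistic models p}` of `⊕_e ℓ^∞_e`, a kernel. -/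
def kernel : OperatorSystem.Kernel G.DirectSum where
  carrier := ⨅ p : {p : V → ℝ // G.IsProbModel p}, LinearMap.ker (G.pairing p)
  isKernel := by
    have hE : (G.edges.card : ℂ) ≠ 0 := by
      exact_mod_cast G.nonempty.card_pos.ne'
    refine ⟨{f | ∃ p, G.IsProbModel p ∧ f = (G.edges.card : ℂ)⁻¹ • G.pairing p}, ?_, ?_⟩
    · rintro f ⟨p, hp, rfl⟩
      refine ⟨?_, fun u hu => ?_⟩
      · have : ∀ e : G.Edge, ∑ x : {x : V // x ∈ e.1}, (p x : ℂ) = 1 := by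
          intro e
          rw [Finset.sum_coe_sort e.1 (fun x => (p x : ℂ))]
          exact_mod_cast hp.2 e.1 e.2
        change (G.edges.card : ℂ)⁻¹ * G.pairing p 1 = 1
        rw [pairing_apply]
        simp only [Pi.one_apply, mul_one, this]
        simp [G.nonempty.ne_empty]
      · refine mul_nonneg (inv_nonneg.2 (Nat.cast_nonneg _)) ?_
        refine Finset.sum_nonneg fun e _ => Finset.sum_nonneg fun x _ => ?_
        refine mul_nonneg (Complex.zero_le_real.2 (hp.1 x).1) ?_
        exact (hu ⟨e, x⟩).diag_nonneg (i := 0)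
    · intro u
      simp only [Submodule.mem_iInf, LinearMap.mem_ker, Subtype.forall, Set.mem_ofPred_eq]
      constructor
      · rintro h f ⟨p, hp, rfl⟩
        simp [h p hp]
      · intro h p hp
        simpa [hE, G.nonempty.ne_empty] using h _ ⟨p, hp, rfl⟩

/-- The universal operator system `S_G`, the quotient of `⊕_e ℓ^∞_e` by `kernel`. -/
abbrev SG : Type _ := OperatorSystem.QuotientSystem G.kernel

variable [DecidableEq V]

/-- The element `δ_x^e` of `ℓ^∞_e`. -/
def delta {G : ContextualityScenario V} (e : G.Edge) (x : V) : EllInfty e :=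
  fun y => if y.1 = x then 1 else 0

/-- The natural embedding `ι_e : ℓ^∞_e → ⊕_f ℓ^∞_f`. -/
def incl (e : G.Edge) : EllInfty e →ₗ[ℂ] G.DirectSum where
  toFun u i := if h : i.1 = e then u ⟨i.2.1, h ▸ i.2.2⟩ else 0
  map_add' u v := by ext i; by_cases h : i.1 = e <;> simp [h]
  map_smul' c u := by ext i; by_cases h : i.1 = e <;> simp [h]

lemma incl_apply (e : G.Edge) (u : EllInfty e) (i : Σ e : G.Edge, {x : V // x ∈ e.1}) :
    G.incl e u i = if h : i.1 = e then u ⟨i.2.1, h ▸ i.2.2⟩ else 0 := rfl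

/-- The map `i_e = |E| (q ∘ ι_e) : ℓ^∞_e → S_G`. -/
def iMap (e : G.Edge) : EllInfty e →ₗ[ℂ] G.SG :=
  (G.edges.card : ℂ) • (OperatorSystem.QuotientSystem.mk G.kernel ∘ₗ G.incl e)

/-- An edge containing a given vertex. -/
noncomputable def someEdge (x : V) : G.Edge :=
  ⟨(G.cover x).choose, (G.cover x).choose_spec.1⟩

/-- The canonical generators `a_x = i_e(δ_x^e)` of `S_G`, where `e` is any edge containing `x`. -/
noncomputable def gen (x : V) : G.SG := G.iMap (G.someEdge x) (delta (G.someEdge x) x)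

lemma pairing_incl_delta (p : V → ℝ) (e : G.Edge) {x : V} (hx : x ∈ e.1) :
    G.pairing p (G.incl e (delta e x)) = p x := by
  simp only [pairing_apply, incl_apply]
  rw [Finset.sum_eq_single e, Finset.sum_eq_single ⟨x, hx⟩]
  · simp [delta]
  · intro y _ hy
    have : y.1 ≠ x := fun h => hy (Subtype.ext h)
    simp [delta, this]
  · simp
  · intro f _ hf
    simp [hf]
  · simp

/-- `a_x` does not depend on the choice of the edge. -/
lemma iMap_delta (e : G.Edge) {x : V} (hx : x ∈ e.1) : G.iMap e (delta e x) = G.gen x := by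
  have hx' : x ∈ (G.someEdge x).1 := (G.cover x).choose_spec.2
  simp only [gen, iMap, LinearMap.smul_apply, LinearMap.comp_apply]
  congr 1
  rw [← sub_eq_zero, ← map_sub, OperatorSystem.QuotientSystem.mk_eq_zero]
  simp only [kernel, Submodule.mem_iInf, LinearMap.mem_ker]
  intro p
  rw [map_sub, pairing_incl_delta _ _ _ hx, pairing_incl_delta _ _ _ hx', sub_self]

end ContextualityScenario

/-! A positive functional on `M_n(S)` separates a Hermitian matrix from the cone (Hahn–Banach),
and it is a vector functional of a unital completely positive map into `B(ℂⁿ)`. So the unital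
completely positive maps into the `B(H)` determine the matrix order of `S`, and in particular
states separate points.

A state of any operator system carrying a compatible family `r_e` restricts to a probabilistic
model. Hence the average `|E|⁻¹ ∑ r_e` kills the kernel, and descends to a map `σ` on `S_G` with
`σ ∘ i_e = r_e`. A POR is such a family, which is the first part.

For the second part, the hypothesis says that each unital completely positive map `S_G → B(H)`
extends uniquely along `σ : S_G → R`. Existence makes `σ` a complete order embedding. By
uniqueness, functionals in the span of the states of `R` are determined on the range of `σ`; this
span separates the points of `R`, so as `S_G` is finite dimensional, `σ` is onto. -/

open scoped Matrix ComplexStarModule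

universe v

namespace OperatorSystem

/-! ### Separation by positive functionals -/

section separation

variable {E : Type*} [AddCommGroup E] [Module ℝ E] {C : PointedCone ℝ E} {u z : E}

lemma nonneg_of_smul_mem_sup_hull_neg (hu : u ∈ C) (hC : ∀ x, ∃ t : ℝ, t • u - x ∈ C)
    (hz : z ∉ C) {a : ℝ} (ha : a • u ∈ C ⊔ PointedCone.hull ℝ {-z}) : 0 ≤ a := by
  by_contra! ha_neg
  have smul_mem {t : ℝ} (ht : 0 ≤ t) {x : E} (hx : x ∈ C) : t • x ∈ C := C.smul_mem ht hx
  obtain ⟨c, hc, d, hd, hcd⟩ := Submodule.mem_sup.1 ha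
  obtain ⟨⟨t, ht⟩, rfl⟩ := Submodule.mem_span_singleton.1 hd
  change c + t • -z = a • u at hcd
  rcases ht.eq_or_lt with rfl | ht
  · have neg_u_mem : -u ∈ C := by
      convert smul_mem (inv_nonneg.2 (neg_nonneg.2 ha_neg.le)) hc using 1
      rw [← add_zero c, ← zero_smul ℝ (-z), hcd, smul_smul, inv_neg, neg_mul,
        inv_mul_cancel₀ ha_neg.ne, neg_one_smul]
    obtain ⟨s, hs⟩ := hC (-z)
    refine hz ?_
    rcases le_total 0 s with hs0 | hs0
    · convert C.add_mem hs (smul_mem hs0 neg_u_mem) using 1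
      module
    · convert C.add_mem hs (smul_mem (neg_nonneg.2 hs0) hu) using 1
      module
  · have tz_mem : t • z ∈ C := by
      convert C.add_mem hc (smul_mem (neg_nonneg.2 ha_neg.le) hu) using 1
      rw [neg_smul, ← hcd]
      module
    exact hz (by simpa [smul_smul, ht.ne'] using smul_mem (inv_nonneg.2 ht.le) tz_mem)

lemma exists_nonneg_apply_eq_one_of_notMem (hu : u ∈ C) (hC : ∀ x, ∃ t : ℝ, t • u - x ∈ C)
    (hz : z ∉ C) : ∃ f : E →ₗ[ℝ] ℝ, (∀ x ∈ C, 0 ≤ f x) ∧ f u = 1 ∧ f z ≤ 0 := by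
  have hu0 : u ≠ 0 := by
    rintro rfl
    obtain ⟨t, ht⟩ := hC (-z)
    exact hz (by simpa using ht)
  let P := C ⊔ PointedCone.hull ℝ {-z}
  have le_P : C ≤ P := le_sup_left
  obtain ⟨f, hfu, hfP⟩ := riesz_extension P
    (LinearPMap.mkSpanSingleton (σ := RingHom.id ℝ) u (1 : ℝ) hu0)
    (by
      rintro ⟨x, hx⟩ hxP
      obtain ⟨a, rfl⟩ := Submodule.mem_span_singleton.1 hx
      rw [LinearPMap.mkSpanSingleton'_apply]
      simpa using nonneg_of_smul_mem_sup_hull_neg hu hC hz hxP)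
    (fun x => by
      obtain ⟨t, ht⟩ := hC (-x)
      exact ⟨⟨t • u, Submodule.smul_mem _ _ (Submodule.mem_span_singleton_self u)⟩,
        le_P (by simpa using ht)⟩)
  refine ⟨f, fun x hx => hfP x (le_P hx), ?_, ?_⟩
  · simpa only [LinearPMap.mkSpanSingleton_apply] using
      hfu ⟨u, Submodule.mem_span_singleton_self u⟩
  · have neg_z_mem : -z ∈ P :=
      Submodule.mem_sup_right (Submodule.mem_span_singleton_self (-z))
    simpa using hfP _ neg_z_mem

end separation

section positive

variable {S : Type*} [AddCommGroup S] [Module ℂ S] [StarAddMonoid S] [StarModule ℂ S]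
  [OperatorSystem S] {n : ℕ}

lemma matUnit_mem (n : ℕ) : matUnit S n ∈ cone n := by
  simpa using smul_matUnit_mem (S := S) n zero_le_one

lemma sum_mem {ι : Type*} (s : Finset ι) {X : ι → Matrix (Fin n) (Fin n) S}
    (h : ∀ i ∈ s, X i ∈ cone n) : ∑ i ∈ s, X i ∈ cone n :=
  Finset.sum_induction X (· ∈ cone n) (fun _ _ => add_mem) (zero_mem n) h

/-- The cone `M_n(S)⁺` as a convex cone in the real vector space `M_n(S)_h`. -/
def hermitianCone (S : Type*) [AddCommGroup S] [Module ℂ S] [StarAddMonoid S] [StarModule ℂ S]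
    [OperatorSystem S] (n : ℕ) : PointedCone ℝ (selfAdjoint (Matrix (Fin n) (Fin n) S)) where
  carrier := {X | X.1 ∈ cone n}
  add_mem' := add_mem
  zero_mem' := zero_mem n
  smul_mem' c _ hX := smul_mem c.2 hX

/-- Positive linear functionals on `M_n(S)`. -/
def IsPosFunctional (F : Matrix (Fin n) (Fin n) S →ₗ[ℂ] ℂ) : Prop :=
  ∀ X ∈ cone n, 0 ≤ F X

lemma exists_isPosFunctional_lt_zero {Y : Matrix (Fin n) (Fin n) S} (hY : Y.IsHermitian)
    (hYc : Y ∉ cone n) : ∃ F : Matrix (Fin n) (Fin n) S →ₗ[ℂ] ℂ,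
      IsPosFunctional F ∧ F (matUnit S n) = 1 ∧ F Y < 0 := by
  obtain ⟨ε, hε, hεY⟩ : ∃ ε : ℝ, 0 < ε ∧ (ε : ℂ) • matUnit S n + Y ∉ cone n := by
    by_contra! h
    exact hYc (archimedean Y h)
  let u : selfAdjoint (Matrix (Fin n) (Fin n) S) :=
    ⟨matUnit S n, isHermitian_of_mem (matUnit_mem n)⟩
  let y : selfAdjoint (Matrix (Fin n) (Fin n) S) := ⟨Y, hY⟩
  obtain ⟨f, hf, hfu, hfy⟩ := exists_nonneg_apply_eq_one_of_notMem (C := hermitianCone S n)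
    (u := u) (z := ε • u + y) (matUnit_mem n)
    (fun X => (order_unit X.1 X.2).imp fun _ h => h.2) hεY
  let F : Module.Dual ℂ (Matrix (Fin n) (Fin n) S) := Module.Dual.extendRCLike (f ∘ₗ realPart)
  have hF (X : selfAdjoint (Matrix (Fin n) (Fin n) S)) : F X = f X := by
    simp [F, Module.Dual.extendRCLike_apply, realPart_I_smul]
  refine ⟨F, fun X hX => ?_, ?_, ?_⟩
  · rw [hF ⟨X, isHermitian_of_mem hX⟩]
    exact Complex.zero_le_real.2 (hf _ hX)
  · rw [hF u, hfu, Complex.ofReal_one]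
  · rw [hF y, ← Complex.ofReal_zero, Complex.real_lt_real]
    rw [map_add, map_smul, hfu, smul_eq_mul, mul_one] at hfy
    linarith

namespace IsPosFunctional

variable {F : Matrix (Fin n) (Fin n) S →ₗ[ℂ] ℂ}

lemma im_eq_zero (hF : IsPosFunctional F) {X : Matrix (Fin n) (Fin n) S} (hX : X.IsHermitian) :
    (F X).im = 0 := by
  obtain ⟨r, -, h⟩ := order_unit X hX
  have him := (Complex.nonneg_iff.1 (hF _ h)).2
  have him_unit := (Complex.nonneg_iff.1 (hF _ (matUnit_mem n))).2
  rw [matUnit] at him_unit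
  rw [map_sub, map_smul, Complex.sub_im, smul_eq_mul, Complex.im_ofReal_mul, ← him_unit] at him
  linarith

lemma map_conjTranspose (hF : IsPosFunctional F) (X : Matrix (Fin n) (Fin n) S) :
    F Xᴴ = star (F X) := by
  have hre := hF.im_eq_zero (ℜ X).2
  have him := hF.im_eq_zero (ℑ X).2
  have hstar : Xᴴ = (ℜ X : Matrix (Fin n) (Fin n) S) - Complex.I • (ℑ X : Matrix _ _ S) := by
    conv_lhs => rw [← realPart_add_I_smul_imaginaryPart X]
    rw [← Matrix.star_eq_conjTranspose, star_add, star_smul, (ℜ X).2.star_eq, (ℑ X).2.star_eq]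
    simp [sub_eq_add_neg]
  conv_rhs => rw [← realPart_add_I_smul_imaginaryPart X]
  rw [hstar]
  apply Complex.ext <;> simp [hre, him]

end IsPosFunctional

end positive

/-! ### States -/

section states

variable {S T U : Type*} [AddCommGroup S] [Module ℂ S] [StarAddMonoid S] [StarModule ℂ S]
  [OperatorSystem S] [AddCommGroup T] [Module ℂ T] [StarAddMonoid T] [StarModule ℂ T]
  [OperatorSystem T] [AddCommGroup U] [Module ℂ U] [StarAddMonoid U] [StarModule ℂ U]
  [OperatorSystem U]

/-- An element of `S` as a `1 × 1` matrix, so that `matOne x ∈ cone 1` says that `x` is positive. -/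
abbrev matOne {S : Type*} (x : S) : Matrix (Fin 1) (Fin 1) S := Matrix.of fun _ _ => x

lemma matOne_unit : matOne (unit : S) = matUnit S 1 := by
  ext i j
  rw [Subsingleton.elim i j, matUnit, Matrix.diagonal_apply_eq]
  rfl

lemma exists_isState_lt_zero {x : S} (hx : IsSelfAdjoint x) (hxc : matOne x ∉ cone 1) :
    ∃ f : S →ₗ[ℂ] ℂ, IsState f ∧ f x < 0 := by
  obtain ⟨F, hF, hF1, hFx⟩ := exists_isPosFunctional_lt_zero
    (show (matOne x).IsHermitian by ext; exact hx) hxc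
  let matOneₗ : S →ₗ[ℂ] Matrix (Fin 1) (Fin 1) S :=
    { toFun := matOne, map_add' := fun _ _ => rfl, map_smul' := fun _ _ => rfl }
  exact ⟨F ∘ₗ matOneₗ, ⟨(congrArg F matOne_unit).trans hF1, fun y hy => hF _ hy⟩, hFx⟩

lemma eq_zero_of_forall_isState {x : S} (hx : ∀ f : S →ₗ[ℂ] ℂ, IsState f → f x = 0) : x = 0 := by
  have eq_zero_of_isSelfAdjoint (y : selfAdjoint S)
      (hy : ∀ f : S →ₗ[ℂ] ℂ, IsState f → f y = 0) : (y : S) = 0 := by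
    have matOne_mem (z : S) (hz : IsSelfAdjoint z) (h0 : ∀ f : S →ₗ[ℂ] ℂ, IsState f → f z = 0) :
        matOne z ∈ cone 1 := by
      by_contra hzc
      obtain ⟨f, hf, hfz⟩ := exists_isState_lt_zero hz hzc
      exact hfz.ne (h0 f hf)
    exact congrFun₂ (proper (matOne_mem y y.2 hy)
      (matOne_mem (-y) y.2.neg fun f hf => by rw [map_neg, hy f hf, neg_zero])) 0 0
  have map_star_eq_zero (f : S →ₗ[ℂ] ℂ) (hf : IsState f) : f (star x) = 0 := by
    rw [hf.map_star, hx f hf, star_zero]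
  rw [← realPart_add_I_smul_imaginaryPart x, eq_zero_of_isSelfAdjoint (ℜ x),
    eq_zero_of_isSelfAdjoint (ℑ x), smul_zero, add_zero]
  · intro f hf
    simp [imaginaryPart_apply_coe, hx f hf, map_star_eq_zero f hf]
  · intro f hf
    simp [realPart_apply_coe, hx f hf, map_star_eq_zero f hf]

lemma IsCP.comp {ψ : T →ₗ[ℂ] U} {φ : S →ₗ[ℂ] T} (hψ : IsCP ψ) (hφ : IsCP φ) :
    IsCP (ψ ∘ₗ φ) := fun n X hX => hψ n _ (hφ n X hX)

lemma IsUCP.comp {ψ : T →ₗ[ℂ] U} {φ : S →ₗ[ℂ] T} (hψ : IsUCP ψ) (hφ : IsUCP φ) :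
    IsUCP (ψ ∘ₗ φ) :=
  ⟨by rw [LinearMap.comp_apply, hφ.1, hψ.1], hψ.2.comp hφ.2⟩

lemma IsState.comp {f : T →ₗ[ℂ] ℂ} {φ : S →ₗ[ℂ] T} (hf : IsState f) (hφ : IsUCP φ) :
    IsState (f ∘ₗ φ) :=
  ⟨by rw [LinearMap.comp_apply, hφ.1, hf.1], fun _ hx => hf.2 _ (hφ.2 1 _ hx)⟩

lemma IsUCP.map_star {φ : S →ₗ[ℂ] T} (hφ : IsUCP φ) (x : S) : φ (star x) = star (φ x) :=
  sub_eq_zero.1 <| eq_zero_of_forall_isState fun f hf => by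
    have hfφ := (hf.comp hφ).map_star x
    rw [LinearMap.comp_apply, LinearMap.comp_apply] at hfφ
    rw [map_sub, hfφ, hf.map_star, sub_self]

end states

/-! ### Tensors of scalar matrices with elements -/

section tensor

variable {S : Type*} [AddCommGroup S] [Module ℂ S] {n m : ℕ}

/-- The elementary tensor `M ⊗ s` in `M_n(S) = M_n ⊗ S`. -/
def matTensor : Matrix (Fin n) (Fin n) ℂ →ₗ[ℂ] S →ₗ[ℂ] Matrix (Fin n) (Fin n) S :=
  LinearMap.mk₂ ℂ (fun M s => M.map (· • s)) (fun _ _ _ => by ext; simp [add_smul])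
    (fun _ _ _ => by ext; simp [smul_smul]) (fun _ _ _ => by ext; simp)
    (fun _ _ _ => by ext; simp [smul_smul, mul_comm])

lemma matTensor_apply (M : Matrix (Fin n) (Fin n) ℂ) (s : S) (i j : Fin n) :
    matTensor M s i j = M i j • s := rfl

lemma matCompress_eq_sum_matTensor (T : Matrix (Fin n) (Fin m) ℂ)
    (X : Matrix (Fin n) (Fin n) S) :
    matCompress T X = ∑ k, ∑ l, matTensor (Matrix.vecMulVec (star (T k)) (T l)) (X k l) := by
  ext i j
  simp [matCompress, Matrix.sum_apply, matTensor_apply, Matrix.vecMulVec_apply]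

lemma matCompress_one (X : Matrix (Fin n) (Fin n) S) : matCompress 1 X = X := by
  ext i j
  simp [matCompress, Matrix.one_apply, apply_ite star]

variable [StarAddMonoid S] [StarModule ℂ S] [OperatorSystem S]

lemma matTensor_one_unit : matTensor 1 (unit : S) = matUnit S n := by
  ext i j
  simp [matTensor_apply, matUnit, Matrix.one_apply, Matrix.diagonal_apply]

open scoped MatrixOrder in
lemma matTensor_mem_cone {M : Matrix (Fin n) (Fin n) ℂ} (hM : M.PosSemidef) {a : S}
    (ha : matOne a ∈ cone 1) : matTensor M a ∈ cone n := by
  obtain ⟨B, rfl⟩ := CStarAlgebra.nonneg_iff_eq_star_mul_self.mp hM.nonneg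
  convert sum_mem Finset.univ
    (X := fun k => matCompress (Matrix.of fun (_ : Fin 1) i => B k i) (matOne a))
    (fun _ _ => compress_mem _ ha) using 1
  ext i j
  simp [matTensor_apply, matCompress, Matrix.mul_apply, Matrix.sum_apply, Finset.sum_smul]

lemma matOne_trace_mem_cone {X : Matrix (Fin n) (Fin n) S} (hX : X ∈ cone n) :
    matOne X.trace ∈ cone 1 := by
  convert sum_mem Finset.univ (X := fun i => matCompress (Matrix.of fun k (_ : Fin 1) =>
    (1 : Matrix (Fin n) (Fin n) ℂ) i k) X) (fun _ _ => compress_mem _ hX) using 1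
  ext
  simp [matCompress, Matrix.sum_apply, Matrix.trace, Matrix.one_apply, apply_ite star]

end tensor

/-! ### States as maps into scalar operators -/

section scalar

variable {S : Type*} [AddCommGroup S] [Module ℂ S] [StarAddMonoid S] [StarModule ℂ S]
  [OperatorSystem S] {H : Type*} [NormedAddCommGroup H] [InnerProductSpace ℂ H] [CompleteSpace H]

lemma matOne_mem_cone_iff_isPositive {A : H →L[ℂ] H} : matOne A ∈ cone 1 ↔ A.IsPositive := by
  have isHermitian_iff : (matOne A).IsHermitian ↔ IsSelfAdjoint A :=
    ⟨fun h => h.apply 0 0, fun h => by ext1; exact h⟩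
  rw [ContinuousLinearMap.isPositive_iff', ← isHermitian_iff]
  refine and_congr_right fun hA => ?_
  have inner_map_self (x : H) : inner ℂ (A x) x = inner ℂ x (A x) :=
    (isHermitian_iff.1 hA).isSymmetric x x
  simp only [inner_map_self]
  exact ⟨fun h x => by simpa using h fun _ => x, fun h ξ => by simpa using h (ξ 0)⟩

lemma IsState.isUCP_smulRight {f : S →ₗ[ℂ] ℂ} (hf : IsState f) :
    IsUCP (f.smulRight (1 : H →L[ℂ] H)) :=
  ⟨by rw [LinearMap.smulRight_apply, hf.1, one_smul]; rfl, fun _ _ hX =>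
    matTensor_mem_cone (hf.map_posSemidef hX)
      (matOne_mem_cone_iff_isPositive.2 ContinuousLinearMap.isPositive_one)⟩

end scalar

/-! ### Positive functionals on matrices as completely positive maps -/

section choi

variable {S : Type*} [AddCommGroup S] [Module ℂ S] {ι : Type*} [Fintype ι] [DecidableEq ι] {n : ℕ}
  (F : Matrix (Fin n) (Fin n) S →ₗ[ℂ] ℂ) (D : Matrix (Fin n) ι ℂ)

/-- The map `S → M_n`, `s ↦ (F (E_kl ⊗ s))_kl`, that corresponds to a functional `F` on `M_n(S)`. -/
def choiMatrix : S →ₗ[ℂ] Matrix (Fin n) (Fin n) ℂ where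
  toFun s := Matrix.of fun k l => F (Matrix.single k l s)
  map_add' _ _ := by ext; simp [Matrix.single_add]
  map_smul' _ _ := by ext; simp [← Matrix.smul_single]

/-- The map `s ↦ D* (F (E_kl ⊗ s))_kl D` into the operators on `ℂ^ι`. -/
noncomputable def choiMap : S →ₗ[ℂ] (EuclideanSpace ℂ ι →L[ℂ] EuclideanSpace ℂ ι) where
  toFun s := Matrix.toEuclideanCLM (𝕜 := ℂ) (n := ι) (Dᴴ * choiMatrix F s * D)
  map_add' _ _ := by simp [Matrix.mul_add, Matrix.add_mul]
  map_smul' _ _ := by simp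

lemma choiMap_apply (s : S) : choiMap F D s =
    Matrix.toEuclideanCLM (𝕜 := ℂ) (n := ι) (Dᴴ * choiMatrix F s * D) := rfl

lemma star_dotProduct_choiMatrix_mulVec (s : S) (v w : Fin n → ℂ) :
    star v ⬝ᵥ choiMatrix F s *ᵥ w = F (matTensor (Matrix.vecMulVec (star v) w) s) := by
  have apply_single (k l : Fin n) (c : ℂ) : F (Matrix.single k l (c • s)) =
      c * choiMatrix F s k l := by
    rw [← Matrix.smul_single, map_smul]
    rfl
  rw [Matrix.matrix_eq_sum_single (matTensor _ s)]
  simp only [map_sum, matTensor_apply, apply_single, Matrix.vecMulVec_apply, dotProduct,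
    Matrix.mulVec, Finset.mul_sum]
  exact Finset.sum_congr rfl fun k _ => Finset.sum_congr rfl fun l _ => by ring

lemma inner_choiMap (s : S) (x y : EuclideanSpace ℂ ι) : inner ℂ x (choiMap F D s y) =
    F (matTensor (Matrix.vecMulVec (star (D *ᵥ x.ofLp)) (D *ᵥ y.ofLp)) s) := by
  rw [← star_dotProduct_choiMatrix_mulVec, choiMap_apply, EuclideanSpace.inner_eq_star_dotProduct,
    Matrix.ofLp_toEuclideanCLM, Matrix.star_mulVec, ← Matrix.dotProduct_mulVec,
    Matrix.mulVec_mulVec, Matrix.mulVec_mulVec, dotProduct_comm, Matrix.mul_assoc]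

lemma sum_inner_choiMap {m : ℕ} (X : Matrix (Fin m) (Fin m) S) (ξ : Fin m → EuclideanSpace ℂ ι) :
    ∑ a, ∑ b, inner ℂ (ξ a) (choiMap F D (X a b) (ξ b)) =
      F (matCompress (Matrix.of fun a => D *ᵥ (ξ a).ofLp) X) := by
  simp only [inner_choiMap, matCompress_eq_sum_matTensor, map_sum]
  rfl

variable [StarAddMonoid S] [StarModule ℂ S] [OperatorSystem S] {F}

lemma choiMap_unit (hD : Dᴴ * choiMatrix F (unit : S) * D = 1) : choiMap F D (unit : S) = 1 := by
  rw [choiMap_apply, hD, map_one]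

namespace IsPosFunctional

lemma conjTranspose_choiMatrix (hF : IsPosFunctional F) (s : S) :
    (choiMatrix F s)ᴴ = choiMatrix F (star s) := by
  ext k l
  exact (hF.map_conjTranspose _).symm.trans (congrArg F (Matrix.conjTranspose_single _ _ _))

lemma isCP_choiMap (hF : IsPosFunctional F) : IsCP (choiMap F D) := by
  refine fun m X hX => ⟨?_, fun ξ => ?_⟩
  · ext1 a b
    rw [Matrix.conjTranspose_apply, Matrix.map_apply, Matrix.map_apply, choiMap_apply,
      choiMap_apply, ← map_star, Matrix.star_eq_conjTranspose, Matrix.conjTranspose_mul,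
      Matrix.conjTranspose_mul, Matrix.conjTranspose_conjTranspose, hF.conjTranspose_choiMatrix,
      (isHermitian_of_mem hX).apply, Matrix.mul_assoc]
  · simp only [Matrix.map_apply, sum_inner_choiMap]
    exact hF _ (compress_mem _ hX)

lemma posSemidef_choiMatrix_unit (hF : IsPosFunctional F) : (choiMatrix F (unit : S)).PosSemidef :=
  .of_dotProduct_mulVec_nonneg
    ((hF.conjTranspose_choiMatrix _).trans (congrArg _ isHermitian_unit)) fun v => by
      rw [star_dotProduct_choiMatrix_mulVec]
      refine hF _ (matTensor_mem_cone ?_ (matOne_unit (S := S) ▸ matUnit_mem 1))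
      simpa using Matrix.posSemidef_vecMulVec_star_self v

lemma exists_choiMatrix_unit_eq_one (hF : IsPosFunctional F) (hF1 : F (matUnit S n) = 1) :
    ∃ τ : Matrix (Fin n) (Fin n) S →ₗ[ℂ] ℂ, IsPosFunctional τ ∧ choiMatrix τ (unit : S) = 1 := by
  refine ⟨F ∘ₗ matTensor 1 ∘ₗ Matrix.traceLinearMap (Fin n) ℂ S, fun X hX =>
    hF _ (matTensor_mem_cone .one (matOne_trace_mem_cone hX)), ?_⟩
  ext k l
  change F (matTensor 1 (Matrix.single k l (unit : S)).trace) = _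
  obtain rfl | hkl := eq_or_ne k l
  · rw [Matrix.trace_single_eq_same, matTensor_one_unit, hF1, Matrix.one_apply_eq]
  · rw [Matrix.trace_single_eq_of_ne _ _ _ hkl, map_zero, map_zero, Matrix.one_apply_ne hkl]

end IsPosFunctional

lemma exists_isPosFunctional_posDef_lt_zero {Y : Matrix (Fin n) (Fin n) S} (hY : Y.IsHermitian)
    (hYc : Y ∉ cone n) : ∃ F : Matrix (Fin n) (Fin n) S →ₗ[ℂ] ℂ,
      IsPosFunctional F ∧ (choiMatrix F (unit : S)).PosDef ∧ (F Y).re < 0 := by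
  obtain ⟨F, hF, hF1, hFY⟩ := exists_isPosFunctional_lt_zero hY hYc
  -- Adding a small multiple of `τ` makes the Choi matrix of the unit invertible.
  obtain ⟨τ, hτ, hτ1⟩ := hF.exists_choiMatrix_unit_eq_one hF1
  have hFY_re : (F Y).re < 0 := (Complex.lt_def.1 hFY).1
  obtain ⟨δ, hδ, hδ_lt⟩ : ∃ δ : ℝ, 0 < δ ∧ δ * (τ Y).re < -(F Y).re :=
    ((eventually_mem_nhdsWithin (a := (0 : ℝ)) (s := Set.Ioi 0)).and
      (((continuous_mul_const (τ Y).re).tendsto' 0 0 (zero_mul _)).mono_left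
        nhdsWithin_le_nhds |>.eventually_lt_const (neg_pos.2 hFY_re))).exists
  refine ⟨F + (δ : ℂ) • τ, fun X hX => ?_, ?_, ?_⟩
  · exact add_nonneg (hF X hX) (mul_nonneg (Complex.zero_le_real.2 hδ.le) (hτ X hX))
  · have hchoi : choiMatrix (F + (δ : ℂ) • τ) (unit : S) =
        choiMatrix F unit + (δ : ℂ) • choiMatrix τ unit := rfl
    rw [hchoi, hτ1]
    exact .posSemidef_add hF.posSemidef_choiMatrix_unit
      (Matrix.PosDef.one.smul (Complex.zero_lt_real.2 hδ))
  · rw [LinearMap.add_apply, LinearMap.smul_apply, smul_eq_mul, Complex.add_re,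
      Complex.re_ofReal_mul]
    linarith

end choi

open scoped MatrixOrder in
lemma exists_conjTranspose_mul_mul_eq_one {ι κ : Type*} [Fintype ι] [DecidableEq ι] [Fintype κ]
    [DecidableEq κ] (e : κ ≃ ι) {M : Matrix ι ι ℂ} (hM : M.PosDef) :
    ∃ (D : Matrix ι κ ℂ) (C : Matrix κ ι ℂ), Dᴴ * M * D = 1 ∧ D * C = 1 := by
  obtain ⟨B, rfl⟩ := CStarAlgebra.nonneg_iff_eq_star_mul_self.mp hM.posSemidef.nonneg
  have hB : IsUnit B.det := by
    have hdet := (Matrix.isUnit_iff_isUnit_det _).1 hM.isUnit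
    rw [Matrix.det_mul] at hdet
    exact isUnit_of_mul_isUnit_right hdet
  have hBB : B⁻¹ᴴ * (star B * B) * B⁻¹ = 1 := by
    rw [← Matrix.mul_assoc, Matrix.mul_assoc, Matrix.mul_nonsing_inv B hB, Matrix.mul_one,
      Matrix.star_eq_conjTranspose, ← Matrix.conjTranspose_mul, Matrix.mul_nonsing_inv B hB,
      Matrix.conjTranspose_one]
  refine ⟨B⁻¹.submatrix id e, B.submatrix e id, ?_, ?_⟩
  · calc (B⁻¹.submatrix id e)ᴴ * (star B * B) * B⁻¹.submatrix id e
        = (B⁻¹ᴴ * (star B * B) * B⁻¹).submatrix e e := rfl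
      _ = 1 := by rw [hBB, Matrix.submatrix_one_equiv]
  · rw [Matrix.submatrix_mul_equiv, Matrix.nonsing_inv_mul B hB, Matrix.submatrix_id_id]

section detection

variable {S : Type*} [AddCommGroup S] [Module ℂ S] [StarAddMonoid S] [StarModule ℂ S]
  [OperatorSystem S] {n : ℕ}

theorem mem_cone_of_forall_isUCP {Y : Matrix (Fin n) (Fin n) S} (hY : Y.IsHermitian)
    (h : ∀ (H : Type v) [NormedAddCommGroup H] [InnerProductSpace ℂ H] [CompleteSpace H]
      (φ : S →ₗ[ℂ] (H →L[ℂ] H)), IsUCP φ →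
        Y.map φ ∈ (cone n : Set (Matrix (Fin n) (Fin n) (H →L[ℂ] H)))) : Y ∈ cone n := by
  by_contra hYc
  obtain ⟨F, hF, hFpos, hFY⟩ := exists_isPosFunctional_posDef_lt_zero hY hYc
  obtain ⟨D, C, hD, hDC⟩ :=
    exists_conjTranspose_mul_mul_eq_one (κ := ULift.{v} (Fin n)) Equiv.ulift hFpos
  have hYφ := (h _ (choiMap F D) ⟨choiMap_unit D hD, hF.isCP_choiMap D⟩).2
    fun a => WithLp.toLp 2 (C.col a)
  simp only [Matrix.map_apply, sum_inner_choiMap] at hYφ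
  have hDC_col : (Matrix.of fun a => D *ᵥ C.col a) = 1 := by
    ext a b
    exact (congrFun₂ hDC b a).trans (by simp [Matrix.one_apply, eq_comm])
  rw [hDC_col, matCompress_one] at hYφ
  exact hFY.not_ge (Complex.nonneg_iff.1 hYφ).1

end detection

end OperatorSystem

/-! ### Surjectivity from uniqueness of extensions of states -/

lemma surjective_of_separatingRight {K S R D : Type*} [Field K] [AddCommGroup S] [Module K S]
    [FiniteDimensional K S] [AddCommGroup R] [Module K R] [AddCommGroup D] [Module K D]
    {σ : S →ₗ[K] R} {B : D →ₗ[K] R →ₗ[K] K} (hB : B.SeparatingRight)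
    (hσ : ∀ φ, B φ ∘ₗ σ = 0 → φ = 0) : Function.Surjective σ := by
  have restrict_injective : Function.Injective (σ.dualMap ∘ₗ B) :=
    (injective_iff_map_eq_zero _).2 hσ
  have flip_injective : Function.Injective B.flip :=
    LinearMap.ker_eq_bot.1 (LinearMap.separatingRight_iff_flip_ker_eq_bot.1 hB)
  intro x
  obtain ⟨Φ, hΦ⟩ := LinearMap.dualMap_surjective_of_injective restrict_injective (B.flip x)
  obtain ⟨y, rfl⟩ := (Module.evalEquiv K S).surjective Φ
  exact ⟨y, flip_injective hΦ⟩

namespace OperatorSystem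

section dual

variable {S R : Type*} [AddCommGroup S] [Module ℂ S] [StarAddMonoid S] [StarModule ℂ S]
  [OperatorSystem S] [AddCommGroup R] [Module ℂ R] [StarAddMonoid R] [StarModule ℂ R]
  [OperatorSystem R]

/-- The convex cone of positive linear functionals on `S`. -/
def dualCone (S : Type*) [AddCommGroup S] [Module ℂ S] [StarAddMonoid S] [StarModule ℂ S]
    [OperatorSystem S] : PointedCone ℝ (S →ₗ[ℂ] ℂ) where
  carrier := {p | ∀ x, matOne x ∈ cone 1 → 0 ≤ p x}
  add_mem' hp hq x hx := add_nonneg (hp x hx) (hq x hx)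
  zero_mem' _ _ := le_rfl
  smul_mem' c _ hp x hx := smul_nonneg c.2 (hp x hx)

lemma map_star_of_mem_dualCone {p : S →ₗ[ℂ] ℂ} (hp : p ∈ dualCone S) (x : S) :
    p (star x) = star (p x) := by
  have hF : IsPosFunctional (p ∘ₗ Matrix.entryLinearMap ℂ S (0 : Fin 1) 0) := fun X hX =>
    hp _ (by convert hX; ext i j; rw [Subsingleton.elim i 0, Subsingleton.elim j 0]; rfl)
  exact hF.map_conjTranspose (matOne x)

lemma isState_inv_smul_add {p f : S →ₗ[ℂ] ℂ} (hp : p ∈ dualCone S) (hf : IsState f) :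
    IsState ((p unit + 1)⁻¹ • (p + f)) := by
  have unit_nonneg : 0 ≤ p unit := hp _ (matOne_unit (S := S) ▸ matUnit_mem 1)
  have add_one_pos : 0 < p unit + 1 := add_pos_of_nonneg_of_pos unit_nonneg one_pos
  refine ⟨?_, fun x hx =>
    mul_nonneg (inv_nonneg.2 add_one_pos.le) (add_nonneg (hp x hx) (hf.2 x hx))⟩
  rw [LinearMap.smul_apply, LinearMap.add_apply, hf.1, smul_eq_mul,
    inv_mul_cancel₀ add_one_pos.ne']

lemma eq_of_mem_dualCone_of_comp_eq {σ : S →ₗ[ℂ] R} (hσ : IsUCP σ)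
    (h : ∀ f g : R →ₗ[ℂ] ℂ, IsState f → IsState g → f ∘ₗ σ = g ∘ₗ σ → f = g)
    {p q : R →ₗ[ℂ] ℂ} (hp : p ∈ dualCone R) (hq : q ∈ dualCone R) (hpq : p ∘ₗ σ = q ∘ₗ σ) :
    p = q := by
  by_cases exists_state : ∃ f : R →ₗ[ℂ] ℂ, IsState f
  · obtain ⟨f, hf⟩ := exists_state
    have hunit : p unit = q unit := by
      simpa only [LinearMap.comp_apply, hσ.1] using LinearMap.congr_fun hpq unit
    have hinv : (p unit + 1)⁻¹ ≠ 0 := left_ne_zero_of_mul_eq_one (isState_inv_smul_add hp hf).1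
    have heq := h _ _ (isState_inv_smul_add hp hf) (isState_inv_smul_add hq hf)
      (by rw [LinearMap.smul_comp, LinearMap.smul_comp, LinearMap.add_comp, LinearMap.add_comp,
        hpq, hunit])
    rw [← hunit] at heq
    exact add_right_cancel (smul_right_injective _ hinv heq)
  · push Not at exists_state
    ext x
    rw [eq_zero_of_forall_isState (x := x) fun f hf => (exists_state f hf).elim, map_zero, map_zero]

lemma exists_eq_sub_add_I_smul_sub_of_mem_span {φ : S →ₗ[ℂ] ℂ}
    (hφ : φ ∈ Submodule.span ℂ (dualCone S : Set (S →ₗ[ℂ] ℂ))) :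
    ∃ p ∈ dualCone S, ∃ q ∈ dualCone S, ∃ p' ∈ dualCone S, ∃ q' ∈ dualCone S,
      φ = (p - q) + Complex.I • (p' - q') := by
  induction hφ using Submodule.closure_induction with
  | zero =>
    have zero_mem := (dualCone S).zero_mem
    exact ⟨0, zero_mem, 0, zero_mem, 0, zero_mem, 0, zero_mem, by simp⟩
  | add φ ψ _ _ hφ hψ =>
    obtain ⟨p, hp, q, hq, p', hp', q', hq', rfl⟩ := hφ
    obtain ⟨r, hr, s, hs, r', hr', s', hs', rfl⟩ := hψ
    exact ⟨p + r, (dualCone S).add_mem hp hr, q + s, (dualCone S).add_mem hq hs,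
      p' + r', (dualCone S).add_mem hp' hr', q' + s', (dualCone S).add_mem hq' hs', by module⟩
  | smul_mem c p hp =>
    have mem (t : ℝ) : t⁺ • p ∈ dualCone S ∧ t⁻ • p ∈ dualCone S :=
      ⟨(dualCone S).smul_mem (posPart_nonneg t) hp, (dualCone S).smul_mem (negPart_nonneg t) hp⟩
    refine ⟨_, (mem c.re).1, _, (mem c.re).2, _, (mem c.im).1, _, (mem c.im).2, ?_⟩
    rw [← sub_smul, ← sub_smul, posPart_sub_negPart, posPart_sub_negPart]
    ext x
    simp only [LinearMap.smul_apply, LinearMap.add_apply, smul_eq_mul, Complex.real_smul]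
    linear_combination -(p x) * Complex.re_add_im c

lemma eq_zero_of_mem_span_dualCone_of_comp_eq_zero {σ : S →ₗ[ℂ] R} (hσ : IsUCP σ)
    (h : ∀ f g : R →ₗ[ℂ] ℂ, IsState f → IsState g → f ∘ₗ σ = g ∘ₗ σ → f = g)
    {φ : R →ₗ[ℂ] ℂ} (hφ : φ ∈ Submodule.span ℂ (dualCone R : Set (R →ₗ[ℂ] ℂ)))
    (hφσ : φ ∘ₗ σ = 0) : φ = 0 := by
  obtain ⟨p, hp, q, hq, p', hp', q', hq', rfl⟩ := exists_eq_sub_add_I_smul_sub_of_mem_span hφ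
  have apply_eq_zero (y : S) :
      p (σ y) - q (σ y) + Complex.I * (p' (σ y) - q' (σ y)) = 0 := LinearMap.congr_fun hφσ y
  have apply_eq_zero' (y : S) :
      p (σ y) - q (σ y) - Complex.I * (p' (σ y) - q' (σ y)) = 0 := by
    have hstar := congrArg star (apply_eq_zero (star y))
    simpa [hσ.map_star, map_star_of_mem_dualCone, hp, hq, hp', hq', sub_eq_add_neg] using hstar
  have re_eq : p = q := eq_of_mem_dualCone_of_comp_eq hσ h hp hq <| LinearMap.ext fun y => by
    simp only [LinearMap.comp_apply]
    linear_combination (apply_eq_zero y + apply_eq_zero' y) / 2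
  have im_eq : p' = q' := eq_of_mem_dualCone_of_comp_eq hσ h hp' hq' <| LinearMap.ext fun y => by
    simp only [LinearMap.comp_apply]
    refine mul_left_cancel₀ Complex.I_ne_zero ?_
    linear_combination (apply_eq_zero y - apply_eq_zero' y) / 2
  rw [re_eq, im_eq, sub_self, sub_self, smul_zero, add_zero]

theorem IsUCP.surjective_of_forall_isState [FiniteDimensional ℂ S] {σ : S →ₗ[ℂ] R} (hσ : IsUCP σ)
    (h : ∀ f g : R →ₗ[ℂ] ℂ, IsState f → IsState g → f ∘ₗ σ = g ∘ₗ σ → f = g) :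
    Function.Surjective σ :=
  surjective_of_separatingRight (B := (Submodule.span ℂ (dualCone R : Set (R →ₗ[ℂ] ℂ))).subtype)
    (fun _ hx => eq_zero_of_forall_isState fun f hf => hx ⟨f, Submodule.subset_span hf.2⟩)
    fun φ hφ => Subtype.ext (eq_zero_of_mem_span_dualCone_of_comp_eq_zero hσ h φ.2 hφ)

end dual

/-! ### Maps with unique extension of unital completely positive maps -/

section extension

variable {S R : Type*} [AddCommGroup S] [Module ℂ S] [StarAddMonoid S] [StarModule ℂ S]
  [OperatorSystem S] [AddCommGroup R] [Module ℂ R] [StarAddMonoid R] [StarModule ℂ R]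
  [OperatorSystem R]

/-- Each unital completely positive map `S → B(H)`, with `H` in the universe `v`, factors uniquely
through `σ : S → R`. -/
def HasUniqueUCPExtension (σ : S →ₗ[ℂ] R) : Prop :=
  ∀ (H : Type v) [NormedAddCommGroup H] [InnerProductSpace ℂ H] [CompleteSpace H]
    (φ : S →ₗ[ℂ] (H →L[ℂ] H)), IsUCP φ → ∃! Ψ : R →ₗ[ℂ] (H →L[ℂ] H), IsUCP Ψ ∧ Ψ ∘ₗ σ = φ

namespace HasUniqueUCPExtension

variable {σ : S →ₗ[ℂ] R}

lemma injective (h : HasUniqueUCPExtension.{v} σ) : Function.Injective σ := by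
  refine (injective_iff_map_eq_zero σ).2 fun y hy => eq_zero_of_forall_isState fun f hf => ?_
  obtain ⟨Ψ, ⟨-, hΨ⟩, -⟩ := h (EuclideanSpace ℂ PUnit.{v + 1}) _ hf.isUCP_smulRight
  have smul_one_eq_zero := LinearMap.congr_fun hΨ.symm y
  rw [LinearMap.comp_apply, hy, map_zero] at smul_one_eq_zero
  exact (smul_eq_zero_iff_left one_ne_zero).1 smul_one_eq_zero

lemma state_ext (h : HasUniqueUCPExtension.{v} σ) (hσ : IsUCP σ) {f g : R →ₗ[ℂ] ℂ}
    (hf : IsState f) (hg : IsState g) (hfg : f ∘ₗ σ = g ∘ₗ σ) : f = g := by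
  have smulRight_eq := (h (EuclideanSpace ℂ PUnit.{v + 1}) _ (hf.comp hσ).isUCP_smulRight).unique
    ⟨hf.isUCP_smulRight, rfl⟩ ⟨hg.isUCP_smulRight, by rw [hfg]; rfl⟩
  ext x
  exact smul_left_injective ℂ one_ne_zero (LinearMap.congr_fun smulRight_eq x)

lemma mem_cone_of_map_mem_cone (h : HasUniqueUCPExtension.{v} σ) (hσ : IsUCP σ) {n : ℕ}
    {Y : Matrix (Fin n) (Fin n) S} (hY : Y.map σ ∈ cone n) : Y ∈ cone n := by
  refine mem_cone_of_forall_isUCP.{v} ?_ fun H _ _ _ φ hφ => ?_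
  · ext i j
    refine h.injective ?_
    rw [Matrix.conjTranspose_apply, hσ.map_star]
    exact (isHermitian_of_mem hY).apply i j
  · obtain ⟨Ψ, ⟨hΨ, rfl⟩, -⟩ := h H φ hφ
    exact hΨ.2 n _ hY

theorem exists_isUnitalCompleteOrderIso [FiniteDimensional ℂ S] (h : HasUniqueUCPExtension.{v} σ)
    (hσ : IsUCP σ) : ∃ θ : R ≃ₗ[ℂ] S, IsUnitalCompleteOrderIso θ ∧ ∀ y, θ (σ y) = y := by
  have hbij : Function.Bijective σ :=
    ⟨h.injective, hσ.surjective_of_forall_isState fun _ _ => h.state_ext hσ⟩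
  let θ : S ≃ₗ[ℂ] R := LinearEquiv.ofBijective σ hbij
  have σ_symm (y : R) : σ (θ.symm y) = y := θ.apply_symm_apply y
  refine ⟨θ.symm, ⟨⟨h.injective ((σ_symm _).trans hσ.1.symm), fun n X hX => ?_⟩, hσ.2⟩,
    θ.symm_apply_apply⟩
  refine h.mem_cone_of_map_mem_cone hσ ?_
  convert hX
  ext i j
  exact σ_symm _

end HasUniqueUCPExtension

end extension

end OperatorSystem

/-! ### Completely positive maps out of quotients and out of `ℓ^∞` -/

namespace OperatorSystem

variable {S R : Type*} [AddCommGroup S] [Module ℂ S] [StarAddMonoid S] [StarModule ℂ S]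
  [OperatorSystem S] [AddCommGroup R] [Module ℂ R] [StarAddMonoid R] [StarModule ℂ R]
  [OperatorSystem R]

lemma QuotientSystem.isUCP_mk (K : Kernel S) : IsUCP (QuotientSystem.mk K) :=
  ⟨rfl, fun n X hX _ hε => ⟨X, rfl, add_mem (smul_matUnit_mem n hε.le) hX⟩⟩

lemma IsUCP.map_matUnit {φ : S →ₗ[ℂ] R} (hφ : IsUCP φ) (n : ℕ) :
    (matUnit S n).map φ = matUnit R n := by
  rw [matUnit, matUnit, Matrix.diagonal_map (map_zero φ)]
  exact congrArg _ (funext fun _ => hφ.1)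

lemma QuotientSystem.exists_isUCP_lift {K : Kernel S} {φ : S →ₗ[ℂ] R} (hφ : IsUCP φ)
    (hK : ∀ u ∈ K.carrier, φ u = 0) :
    ∃ σ : QuotientSystem K →ₗ[ℂ] R, IsUCP σ ∧ ∀ u, σ (QuotientSystem.mk K u) = φ u := by
  refine ⟨K.carrier.liftQ φ hK, ⟨hφ.1, fun n Y hY => archimedean _ fun ε hε => ?_⟩, fun _ => rfl⟩
  obtain ⟨X, rfl, hX⟩ := hY ε hε
  have map_mem := hφ.2 n _ hX
  rw [Matrix.map_add φ (map_add φ), Matrix.map_smul φ _ (map_smul φ _), hφ.map_matUnit] at map_mem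
  exact map_mem

lemma isUCP_average {ι : Type*} [Fintype ι] [Nonempty ι] {φ : ι → S →ₗ[ℂ] R}
    (hφ : ∀ i, IsUCP (φ i)) : IsUCP ((Fintype.card ι : ℂ)⁻¹ • ∑ i, φ i) := by
  refine ⟨?_, fun n X hX => ?_⟩
  · simp [fun i => (hφ i).1, ← Nat.cast_smul_eq_nsmul ℂ, smul_smul]
  · convert smul_mem (r := (Fintype.card ι : ℝ)⁻¹) (by positivity)
      (sum_mem Finset.univ (X := fun i => X.map (φ i)) fun i _ => (hφ i).2 n X hX) using 1
    ext i j
    simp [Matrix.sum_apply]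

section ellInfty

variable {ι κ : Type*} [Finite ι] [Finite κ]

lemma isUCP_funLeft (f : κ → ι) : IsUCP (LinearMap.funLeft ℂ ℂ f) :=
  ⟨rfl, fun _ _ hX k => hX (f k)⟩

lemma matOne_mem_cone_of_nonneg {u : ι → ℂ} (hu : 0 ≤ u) : matOne u ∈ cone 1 := fun i => by
  convert Matrix.PosSemidef.diagonal (n := Fin 1) (d := fun _ => u i) fun _ => hu i
  ext k l
  rw [Subsingleton.elim k l, Matrix.diagonal_apply_eq]
  rfl

lemma isUCP_of_forall_single [DecidableEq ι] {φ : (ι → ℂ) →ₗ[ℂ] S} (hone : φ 1 = unit)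
    (hsingle : ∀ i, matOne (φ (Pi.single i 1)) ∈ cone 1) : IsUCP φ := by
  have := Fintype.ofFinite ι
  refine ⟨hone, fun n X hX => ?_⟩
  convert sum_mem Finset.univ
    (X := fun i => matTensor (X.map fun u => u i) (φ (Pi.single i 1)))
    (fun i _ => matTensor_mem_cone (hX i) (hsingle i)) using 1
  ext k l
  simp only [Matrix.map_apply, Matrix.sum_apply, matTensor_apply]
  conv_lhs => rw [pi_eq_sum_univ' (X k l), map_sum]
  simp only [map_smul]

end ellInfty

end OperatorSystem

namespace ContextualityScenario

open OperatorSystem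

variable {V : Type*} [Finite V] {G : ContextualityScenario V}

/-! ### Probabilistic models -/

instance : Nonempty G.Edge := G.nonempty.to_subtype

lemma card_edges_ne_zero : (G.edges.card : ℂ) ≠ 0 := Nat.cast_ne_zero.2 G.nonempty.card_ne_zero

lemma mem_kernel_iff {u : G.DirectSum} :
    u ∈ G.kernel.carrier ↔ ∀ p, G.IsProbModel p → G.pairing p u = 0 := by
  simp [kernel]

lemma isProbModel_of_forall_nonneg {p : V → ℝ} (hp : ∀ x, 0 ≤ p x)
    (hsum : ∀ e ∈ G.edges, ∑ x ∈ e, p x = 1) : G.IsProbModel p := by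
  refine ⟨fun x => ⟨hp x, ?_⟩, hsum⟩
  obtain ⟨e, he, hx⟩ := G.cover x
  exact (Finset.single_le_sum (fun y _ => hp y) hx).trans_eq (hsum e he)

lemma pairing_one {p : V → ℝ} (hp : G.IsProbModel p) : G.pairing p 1 = G.edges.card := by
  have sum_edge (e : G.Edge) : ∑ x : {x : V // x ∈ e.1}, (p x : ℂ) = 1 := by
    rw [Finset.sum_coe_sort e.1 fun x => (p x : ℂ)]
    exact_mod_cast hp.2 e.1 e.2
  simp only [pairing_apply, Pi.one_apply, mul_one, sum_edge]
  simp

lemma mem_someEdge (x : V) : x ∈ (G.someEdge x).1 := (G.cover x).choose_spec.2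

/-! ### Averages of maps on the edges -/

section average

variable {R : Type*} [AddCommGroup R] [Module ℂ R]

/-- The average `u ↦ |E|⁻¹ ∑_e r_e(u^e)` of a family of maps `r_e : ℓ^∞_e → R`; it restricts to
`|E|⁻¹ r_e` on `ℓ^∞_e`, matching the factor `|E|` in `i_e`. -/
noncomputable def averageMap (r : (e : G.Edge) → EllInfty e →ₗ[ℂ] R) : G.DirectSum →ₗ[ℂ] R :=
  (Fintype.card G.Edge : ℂ)⁻¹ • ∑ e, r e ∘ₗ LinearMap.funLeft ℂ ℂ (fun x => ⟨e, x⟩)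

lemma isUCP_averageMap [StarAddMonoid R] [StarModule ℂ R] [OperatorSystem R]
    {r : (e : G.Edge) → EllInfty e →ₗ[ℂ] R} (hr : ∀ e, IsUCP (r e)) : IsUCP (averageMap r) :=
  isUCP_average fun e => (hr e).comp (isUCP_funLeft _)

end average

lemma IsPOR.isUCP_linearCombination {H : Type*} [NormedAddCommGroup H]
    [InnerProductSpace ℂ H] [CompleteSpace H] {A : V → (H →L[ℂ] H)} (hA : G.IsPOR A) (e : G.Edge) :
    IsUCP (Fintype.linearCombination ℂ fun x : {x : V // x ∈ e.1} => A x) := by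
  classical
  refine isUCP_of_forall_single ?_ fun x => ?_
  · rw [Fintype.linearCombination_apply]
    simp only [Pi.one_apply, one_smul]
    exact (Finset.sum_coe_sort e.1 A).trans (hA.2 e.1 e.2)
  · rw [Fintype.linearCombination_apply_single, one_smul]
    exact matOne_mem_cone_iff_isPositive.2 (hA.1 x)

/-! ### Generators -/

variable [DecidableEq V]

lemma delta_coe (e : G.Edge) (x : {x : V // x ∈ e.1}) : delta e x = Pi.single x 1 := by
  ext y
  simp only [delta, Pi.single_apply, Subtype.ext_iff]

lemma delta_nonneg (e : G.Edge) (x : V) : 0 ≤ delta e x := fun y => by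
  rw [delta]
  split_ifs <;> simp

lemma sum_delta (e : G.Edge) : ∑ x ∈ e.1, delta e x = 1 := by
  rw [← Finset.sum_coe_sort e.1 (delta e)]
  simp only [delta_coe]
  exact Finset.univ_sum_single 1

lemma linearCombination_delta {M : Type*} [AddCommGroup M] [Module ℂ M] (A : V → M) {e : G.Edge}
    {x : V} (hx : x ∈ e.1) :
    Fintype.linearCombination ℂ (fun y : {y : V // y ∈ e.1} => A y) (delta e x) = A x := by
  rw [delta_coe e ⟨x, hx⟩, Fintype.linearCombination_apply_single, one_smul]

lemma incl_delta (e : G.Edge) (x : {x : V // x ∈ e.1}) :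
    G.incl e (delta e x) = Pi.single ⟨e, x⟩ 1 := by
  ext ⟨f, y⟩
  by_cases hfe : f = e
  · subst hfe
    simp [incl_apply, delta_coe, Pi.single_apply]
  · simp [incl_apply, hfe]

lemma incl_nonneg {e : G.Edge} {v : EllInfty e} (hv : 0 ≤ v) : 0 ≤ G.incl e v := fun i => by
  rw [incl_apply]
  split_ifs
  exacts [hv _, le_rfl]

lemma pairing_incl_one {p : V → ℝ} (hp : G.IsProbModel p) (e : G.Edge) :
    G.pairing p (G.incl e 1) = 1 := by
  rw [← sum_delta e, map_sum, map_sum,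
    Finset.sum_congr rfl fun x hx => G.pairing_incl_delta p e hx]
  exact_mod_cast hp.2 e.1 e.2

lemma iMap_one (e : G.Edge) : G.iMap e 1 = unit := by
  change (G.edges.card : ℂ) • QuotientSystem.mk G.kernel (G.incl e 1) =
    QuotientSystem.mk G.kernel 1
  rw [← sub_eq_zero, ← map_smul, ← map_sub, QuotientSystem.mk_eq_zero, mem_kernel_iff]
  intro p hp
  rw [map_sub, map_smul, pairing_incl_one hp, pairing_one hp, smul_eq_mul, mul_one, sub_self]

variable (G) in
theorem isUCP_iMap (e : G.Edge) : IsUCP (G.iMap e) := by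
  refine isUCP_of_forall_single (iMap_one e) fun x => ?_
  have mk_mem := (QuotientSystem.isUCP_mk G.kernel).2 1 _
    (matOne_mem_cone_of_nonneg (incl_nonneg (delta_nonneg e x)))
  rw [← delta_coe]
  exact smul_mem (Nat.cast_nonneg G.edges.card) mk_mem

lemma linearMap_ext {M : Type*} [AddCommGroup M] [Module ℂ M] {φ ψ : G.SG →ₗ[ℂ] M}
    (h : ∀ x, φ (G.gen x) = ψ (G.gen x)) : φ = ψ := by
  suffices φ ∘ₗ QuotientSystem.mk G.kernel = ψ ∘ₗ QuotientSystem.mk G.kernel from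
    (LinearMap.cancel_right (QuotientSystem.mk_surjective G.kernel)).1 this
  refine LinearMap.pi_ext' fun ⟨e, x⟩ => LinearMap.ext_ring ?_
  have gen_eq : G.gen x =
      (G.edges.card : ℂ) • QuotientSystem.mk G.kernel (Pi.single ⟨e, x⟩ 1) := by
    rw [← G.iMap_delta e x.2, ← incl_delta]
    rfl
  have hx := h x
  rw [gen_eq, map_smul, map_smul] at hx
  exact smul_right_injective _ card_edges_ne_zero hx

/-! ### Compatible families of unital completely positive maps -/

section lift

variable {R : Type*} [AddCommGroup R] [Module ℂ R]

/-- A family of linear maps `r_e : ℓ^∞_e → R` is compatible if `r_e(δ_x^e)` depends only on `x`. -/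
def IsCompatible (r : (e : G.Edge) → EllInfty e →ₗ[ℂ] R) : Prop :=
  ∀ (e f : G.Edge) (x : V), x ∈ e.1 → x ∈ f.1 → r e (delta e x) = r f (delta f x)

lemma averageMap_incl (r : (e : G.Edge) → EllInfty e →ₗ[ℂ] R) (e : G.Edge) (v : EllInfty e) :
    averageMap r (G.incl e v) = (G.edges.card : ℂ)⁻¹ • r e v := by
  have funLeft_incl_self : LinearMap.funLeft ℂ ℂ (fun x => ⟨e, x⟩) (G.incl e v) = v := by
    ext x
    simp [LinearMap.funLeft_apply, incl_apply]
  have funLeft_incl_of_ne (f : G.Edge) (hf : f ≠ e) :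
      LinearMap.funLeft ℂ ℂ (fun x => ⟨f, x⟩) (G.incl e v) = 0 := by
    ext x
    simp [LinearMap.funLeft_apply, incl_apply, hf]
  rw [averageMap, LinearMap.smul_apply, LinearMap.sum_apply, Fintype.card_coe,
    Finset.sum_eq_single_of_mem e (Finset.mem_univ e), LinearMap.comp_apply, funLeft_incl_self]
  intro f _ hf
  rw [LinearMap.comp_apply, funLeft_incl_of_ne f hf, map_zero]

variable [StarAddMonoid R] [StarModule ℂ R] [OperatorSystem R]
  {r : (e : G.Edge) → EllInfty e →ₗ[ℂ] R}

lemma IsCompatible.exists_isProbModel (hc : IsCompatible r) (hr : ∀ e, IsUCP (r e))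
    {f : R →ₗ[ℂ] ℂ} (hf : IsState f) :
    ∃ p : V → ℝ, G.IsProbModel p ∧
      ∀ (e : G.Edge) (x : V), x ∈ e.1 → f (r e (delta e x)) = p x := by
  let p (x : V) : ℝ := (f (r (G.someEdge x) (delta (G.someEdge x) x))).re
  have nonneg (e : G.Edge) (x : V) : 0 ≤ f (r e (delta e x)) :=
    (hf.comp (hr e)).2 _ (matOne_mem_cone_of_nonneg (delta_nonneg e x))
  have apply_delta (e : G.Edge) (x : V) (hx : x ∈ e.1) : f (r e (delta e x)) = p x := by
    rw [hc e (G.someEdge x) x hx (mem_someEdge x)]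
    exact Complex.eq_re_of_ofReal_le (nonneg _ _)
  refine ⟨p, isProbModel_of_forall_nonneg (fun x => (Complex.nonneg_iff.1 (nonneg _ x)).1)
    fun e he => ?_, apply_delta⟩
  have map_one : f (r ⟨e, he⟩ 1) = 1 := (hf.comp (hr ⟨e, he⟩)).1
  rw [← sum_delta, map_sum, map_sum, Finset.sum_congr rfl fun x hx => apply_delta ⟨e, he⟩ x hx]
    at map_one
  exact_mod_cast map_one

lemma IsCompatible.averageMap_eq_zero (hc : IsCompatible r) (hr : ∀ e, IsUCP (r e))
    {u : G.DirectSum} (hu : u ∈ G.kernel.carrier) : averageMap r u = 0 := by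
  refine eq_zero_of_forall_isState fun f hf => ?_
  obtain ⟨p, hp, apply_delta⟩ := hc.exists_isProbModel hr hf
  have comp_eq : f ∘ₗ averageMap r = (G.edges.card : ℂ)⁻¹ • G.pairing p := by
    refine LinearMap.pi_ext' fun ⟨e, x⟩ => LinearMap.ext_ring ?_
    change f (averageMap r (Pi.single _ 1)) = (G.edges.card : ℂ)⁻¹ • G.pairing p (Pi.single _ 1)
    rw [← incl_delta, averageMap_incl, map_smul, apply_delta e x x.2, pairing_incl_delta _ _ _ x.2]
  rw [← LinearMap.comp_apply, comp_eq, LinearMap.smul_apply, mem_kernel_iff.1 hu p hp, smul_zero]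

theorem IsCompatible.exists_isUCP_lift (hc : IsCompatible r) (hr : ∀ e, IsUCP (r e)) :
    ∃ σ : G.SG →ₗ[ℂ] R, IsUCP σ ∧ ∀ (e : G.Edge) (v : EllInfty e), σ (G.iMap e v) = r e v := by
  obtain ⟨σ, hσ, hσr⟩ := QuotientSystem.exists_isUCP_lift (isUCP_averageMap hr)
    fun u hu => hc.averageMap_eq_zero hr hu
  refine ⟨σ, hσ, fun e v => ?_⟩
  rw [iMap, LinearMap.smul_apply, map_smul, LinearMap.comp_apply, hσr, averageMap_incl,
    smul_inv_smul₀ card_edges_ne_zero]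

end lift

/-! ### Positive operator representations -/

section POR

variable {H : Type*} [NormedAddCommGroup H] [InnerProductSpace ℂ H] [CompleteSpace H]

theorem isPOR_of_isUCP {Φ : G.SG →ₗ[ℂ] (H →L[ℂ] H)} (hΦ : IsUCP Φ) :
    G.IsPOR (fun x => Φ (G.gen x)) := by
  have isUCP_comp (e : G.Edge) : IsUCP (Φ ∘ₗ G.iMap e) := hΦ.comp (G.isUCP_iMap e)
  refine ⟨fun x => matOne_mem_cone_iff_isPositive.1 ((isUCP_comp (G.someEdge x)).2 1 _
    (matOne_mem_cone_of_nonneg (delta_nonneg _ x))), fun e he => ?_⟩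
  have map_one : (Φ ∘ₗ G.iMap ⟨e, he⟩) 1 = 1 := (isUCP_comp ⟨e, he⟩).1
  rw [← map_one, ← sum_delta, map_sum]
  exact Finset.sum_congr rfl fun x hx => by rw [LinearMap.comp_apply, G.iMap_delta ⟨e, he⟩ hx]

theorem IsPOR.existsUnique_isUCP {A : V → (H →L[ℂ] H)} (hA : G.IsPOR A) :
    ∃! Φ : G.SG →ₗ[ℂ] (H →L[ℂ] H), IsUCP Φ ∧ ∀ x, Φ (G.gen x) = A x := by
  have compatible : IsCompatible fun e : G.Edge =>
      Fintype.linearCombination ℂ fun x : {x : V // x ∈ e.1} => A x := fun e f x he hf => by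
    rw [linearCombination_delta A he, linearCombination_delta A hf]
  obtain ⟨Φ, hΦ, apply_iMap⟩ := compatible.exists_isUCP_lift hA.isUCP_linearCombination
  have apply_gen (x : V) : Φ (G.gen x) = A x :=
    (apply_iMap _ _).trans (linearCombination_delta A (mem_someEdge x))
  exact ⟨Φ, ⟨hΦ, apply_gen⟩, fun Ψ hΨ => linearMap_ext fun x => by rw [hΨ.2, apply_gen]⟩

end POR

section uniqueness

variable {R : Type*} [AddCommGroup R] [Module ℂ R] {r : (e : G.Edge) → EllInfty e →ₗ[ℂ] R}

lemma comp_eq_iff_forall_delta {M : Type*} [AddCommGroup M] [Module ℂ M] {σ : G.SG →ₗ[ℂ] R}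
    (hσ : ∀ (e : G.Edge) (v : EllInfty e), σ (G.iMap e v) = r e v) {Ψ : R →ₗ[ℂ] M}
    {φ : G.SG →ₗ[ℂ] M} : Ψ ∘ₗ σ = φ ↔
      ∀ (e : G.Edge) (x : V), x ∈ e.1 → Ψ (r e (delta e x)) = φ (G.gen x) := by
  refine ⟨?_, fun h => linearMap_ext fun x => ?_⟩
  · rintro rfl e x hx
    rw [← hσ, G.iMap_delta e hx, LinearMap.comp_apply]
  · rw [← h _ x (mem_someEdge x), ← hσ]
    rfl

theorem IsCompatible.exists_isUnitalCompleteOrderIso [StarAddMonoid R] [StarModule ℂ R]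
    [OperatorSystem R] (hc : IsCompatible r) (hr : ∀ e, IsUCP (r e))
    (hu : ∀ (H : Type v) [NormedAddCommGroup H] [InnerProductSpace ℂ H] [CompleteSpace H]
      (A : V → (H →L[ℂ] H)), G.IsPOR A → ∃! Ψ : R →ₗ[ℂ] (H →L[ℂ] H),
        IsUCP Ψ ∧ ∀ (e : G.Edge) (x : V), x ∈ e.1 → Ψ (r e (delta e x)) = A x) :
    ∃ θ : R ≃ₗ[ℂ] G.SG, IsUnitalCompleteOrderIso θ ∧
      ∀ e : G.Edge, (θ : R →ₗ[ℂ] G.SG) ∘ₗ r e = G.iMap e := by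
  obtain ⟨σ, hσ, apply_iMap⟩ := hc.exists_isUCP_lift hr
  have hasUniqueUCPExtension : HasUniqueUCPExtension.{v} σ := fun H _ _ _ φ hφ => by
    simpa only [comp_eq_iff_forall_delta apply_iMap] using hu H _ (isPOR_of_isUCP hφ)
  have : FiniteDimensional ℂ G.SG := Module.Finite.of_surjective (QuotientSystem.mk G.kernel)
    (QuotientSystem.mk_surjective G.kernel)
  obtain ⟨θ, hθ, apply_σ⟩ := hasUniqueUCPExtension.exists_isUnitalCompleteOrderIso hσ
  exact ⟨θ, hθ, fun e => LinearMap.ext fun v => by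
    rw [LinearMap.comp_apply, ← apply_iMap]; exact apply_σ _⟩

end uniqueness

end ContextualityScenario

theorem mainTheorem6 {V : Type*} [Finite V] [DecidableEq V] (G : ContextualityScenario V)
    (hG : G.Nontrivial) :
    -- unital completely positive maps on `S_G` give positive operator representations
    (∀ (H : Type*) [NormedAddCommGroup H] [InnerProductSpace ℂ H] [CompleteSpace H],
      (∀ Φ : G.SG →ₗ[ℂ] (H →L[ℂ] H), OperatorSystem.IsUCP Φ → G.IsPOR (fun x => Φ (G.gen x))) ∧
      -- and every positive operator representation arises from exactly one such map
      (∀ A : V → (H →L[ℂ] H), G.IsPOR A →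
        ∃! Φ : G.SG →ₗ[ℂ] (H →L[ℂ] H), OperatorSystem.IsUCP Φ ∧ ∀ x, Φ (G.gen x) = A x)) ∧
    -- the canonical maps `i_e : ℓ^∞_e → S_G` are unital and completely positive
    (∀ e : G.Edge, OperatorSystem.IsUCP (G.iMap e)) ∧
    -- uniqueness of `S_G`, together with the maps `i_e`
    (∀ (R : Type*) [AddCommGroup R] [Module ℂ R] [StarAddMonoid R] [StarModule ℂ R]
      [OperatorSystem R] (r : (e : G.Edge) → ContextualityScenario.EllInfty e →ₗ[ℂ] R),
      (∀ e, OperatorSystem.IsUCP (r e)) →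
      -- `r_e(δ_x^e)` depends only on `x`
      (∀ (e f : G.Edge) (x : V), x ∈ e.1 → x ∈ f.1 →
        r e (ContextualityScenario.delta e x) = r f (ContextualityScenario.delta f x)) →
      (∀ (H : Type*) [NormedAddCommGroup H] [InnerProductSpace ℂ H] [CompleteSpace H]
        (A : V → (H →L[ℂ] H)), G.IsPOR A →
        ∃! Ψ : R →ₗ[ℂ] (H →L[ℂ] H),
          OperatorSystem.IsUCP Ψ ∧ ∀ (e : G.Edge) (x : V), x ∈ e.1 →
            Ψ (r e (ContextualityScenario.delta e x)) = A x) →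
      ∃ θ : R ≃ₗ[ℂ] G.SG, OperatorSystem.IsUnitalCompleteOrderIso θ ∧
        ∀ e : G.Edge, (θ : R →ₗ[ℂ] G.SG) ∘ₗ r e = G.iMap e) := by
  refine ⟨fun H _ _ _ => ⟨fun Φ hΦ => ContextualityScenario.isPOR_of_isUCP hΦ,
    fun A hA => ContextualityScenario.IsPOR.existsUnique_isUCP hA⟩, G.isUCP_iMap, ?_⟩
  intro R _ _ _ _ _ r hr hc hu
  exact ContextualityScenario.IsCompatible.exists_isUnitalCompleteOrderIso hc hr hu
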